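/- Let $S$ be the monoid with the presentation $$S=\langle a,b,x_n,y_n\ (n\in\mathbb Z)\ :\ abx_n=bx_n,\ aby_n=by_{n+1}\ (n\in\mathbb Z)\rangle .$$ Then $S$ is left cancellative, $S$ is strongly C$^*$-regular, $S$ is not finitely aligned, the canonical quotient map $\mathcal G_P(S)\to\mathcal G(S)$ is an isomorphism of topological groupoids (in short, $\mathcal G_P(S)=\mathcal G(S)$), and this groupoid is not Hausdorff. Here, for a left cancellative monoid $S$, the following definitions are used. The left inverse hull $I_\ell(S)$ is the inverse semigroup of partial bijections of $S$ generated by the left translations $t\mapsto st$. Its semigroup of idempotents is denoted by $E(S)$. The constructible ideals are the right ideals $s_1^{-1}t_1\cdots s_n^{-1}t_nS$, and $\mathcal J(S)$ is the set of all of them. For $X\in\mathcal J(S)$, the identity map of $X$ is denoted by $p_X$; thus $E(S)=\{p_X: X\in\mathcal J(S)\}$. The monoid $S$ is finitely aligned if the right ideal $sS\cap tS$ is finitely generated (possibly empty) for all $s,t\in S$. It is strongly C$^*$-regular if, whenever $h_1,\dots,h_n\in I_\ell(S)$ and $X,X_1,\dots,X_m\in\mathcal J(S)$ satisfy $$\emptyset\ne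 X\setminus\bigcup_{i=1}^m X_i\subset\bigcup_{k=1}^n\{s\in S: h_ks=s\},$$ there are $Y_1,\dots,Y_l\in\mathcal J(S)$ and indices $k_1,\dots,k_l\in\{1,\dots,n\}$ such that $X\setminus\bigcup_i X_i\subset\bigcup_j Y_j$ and $h_{k_j}p_{Y_j}=p_{Y_j}$ for all $j$. Let $\widehat{E(S)}$ be the space of nonzero semigroup homomorphisms $\chi\colon E(S)\to\{0,1\}$ with the topology of pointwise convergence. For $s\in S$ let $\chi_s(p_X)=1$ if $s\in X$ and $\chi_s(p_X)=0$ otherwise, and let $\Omega(S)$ be the closure of $\{\chi_s:s\in S\}$ in $\widehat{E(S)}$. The groupoid $\mathcal G(I_\ell(S))$ consists of the classes $[g,\chi]$ of pairs $(g,\chi)\in I_\ell(S)\times\widehat{E(S)}$ with $\chi(g^{-1}g)=1$, where $[g,\chi]=[h,\psi]$ if and only if $\chi=\psi$ and $gp=hp$ for some $p\in E(S)$ with $\chi(p)=1$. The source of $[g,\chi]$ is $\chi$, its range is $\chi(g^{-1}\cdot g)$, the product is $[g,\chi][h,\psi]=[gh,\psi]$ if $\chi=\psi(h^{-1}\cdot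 h)$, and the inverse is $[g,\chi]^{-1}=[g^{-1},\chi(g^{-1}\cdot g)]$. A basis of the topology is given by the sets $\{[g,\chi]:\chi\in U\}$, where $g\in I_\ell(S)$ and $U$ is an open subset of $\{\chi:\chi(g^{-1}g)=1\}$. The groupoid $\mathcal G_P(S)$ is the restriction of $\mathcal G(I_\ell(S))$ to the closed invariant set $\Omega(S)$. The groupoid $\mathcal G(S)$ is the quotient topological groupoid $\mathcal G_P(S)/{\sim}$, where $[g,\chi]\sim[h,\chi]$ if and only if there are $X,X_1,\dots,X_m\in\mathcal J(S)$, $m\ge 0$, such that $\chi(p_X)=1$, $\chi(p_{X_i})=0$ for all $i$, and $g$ and $h$ coincide on $X\setminus\bigcup_i X_i$. -/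

import Mathlib

/-! ### Groupoids given by a set of arrows over a set of units -/

/-- A groupoid with set of units `X` and set of arrows `A`; the product `mul α β _` is defined
when the source of `α` is the range of `β`. -/
structure ArrowGroupoid (X A : Type*) where
  source : A → X
  range : A → X
  unit : X → A
  inv : A → A
  mul : (α β : A) → source α = range β → A
  source_unit : ∀ x, source (unit x) = x
  range_unit : ∀ x, range (unit x) = x
  source_inv : ∀ α, source (inv α) = range α
  range_inv : ∀ α, range (inv α) = source α
  source_mul : ∀ α β h, source (mul α β h) = source β
  range_mul : ∀ α β h, range (mul α β h) = range α
  unit_mul : ∀ α, mul (unit (range α)) α (source_unit _) = α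
  mul_unit : ∀ α, mul α (unit (source α)) (range_unit _).symm = α
  mul_assoc : ∀ α β γ (h : source α = range β) (k : source β = range γ),
    mul (mul α β h) γ ((source_mul α β h).trans k) =
      mul α (mul β γ k) (h.trans (range_mul β γ k).symm)
  inv_mul : ∀ α, mul (inv α) α (source_inv α) = unit (source α)
  mul_inv : ∀ α, mul α (inv α) (range_inv α).symm = unit (range α)

namespace ArrowGroupoid

variable {X A : Type*}

/-- The restriction of a groupoid to an invariant set of units. -/
def restrict (G : ArrowGroupoid X A) (Z : Set X)
    (hZ : ∀ α, G.source α ∈ Z → G.range α ∈ Z) :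
    ArrowGroupoid Z {α : A // G.source α ∈ Z} where
  source α := ⟨G.source α.1, α.2⟩
  range α := ⟨G.range α.1, hZ _ α.2⟩
  unit x := ⟨G.unit x.1, by rw [G.source_unit]; exact x.2⟩
  inv α := ⟨G.inv α.1, by rw [G.source_inv]; exact hZ _ α.2⟩
  mul α β h := ⟨G.mul α.1 β.1 (congrArg Subtype.val h), by rw [G.source_mul]; exact β.2⟩
  source_unit x := Subtype.ext (G.source_unit _)
  range_unit x := Subtype.ext (G.range_unit _)
  source_inv α := Subtype.ext (G.source_inv _)
  range_inv α := Subtype.ext (G.range_inv _)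
  source_mul α β h := Subtype.ext (G.source_mul _ _ _)
  range_mul α β h := Subtype.ext (G.range_mul _ _ _)
  unit_mul α := Subtype.ext (G.unit_mul _)
  mul_unit α := Subtype.ext (G.mul_unit _)
  mul_assoc α β γ h k := Subtype.ext (G.mul_assoc _ _ _ _ _)
  inv_mul α := Subtype.ext (G.inv_mul _)
  mul_inv α := Subtype.ext (G.mul_inv _)

/-- A congruence on a groupoid that is trivial on units. -/
structure IsCongruence (G : ArrowGroupoid X A) (r : Setoid A) : Prop where
  source_eq : ∀ {α β}, r α β → G.source α = G.source β
  range_eq : ∀ {α β}, r α β → G.range α = G.range β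
  mul : ∀ {α α' β β'} (h : G.source α = G.range β) (h' : G.source α' = G.range β'),
    r α α' → r β β' → r (G.mul α β h) (G.mul α' β' h')

theorem mul_congr (G : ArrowGroupoid X A) {α α' β β' : A} (ha : α = α') (hb : β = β')
    (h : G.source α = G.range β) (h' : G.source α' = G.range β') :
    G.mul α β h = G.mul α' β' h' := by
  subst ha hb; rfl

theorem IsCongruence.inv {G : ArrowGroupoid X A} {r : Setoid A} (hr : G.IsCongruence r)
    {α β : A} (h : r α β) : r (G.inv α) (G.inv β) := by
  have e1 : G.source (G.inv β) = G.range α := by rw [G.source_inv, hr.range_eq h]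
  have e2 : G.source β = G.range (G.inv α) := by rw [G.range_inv, hr.source_eq h]
  have e3 : G.source α = G.range (G.inv α) := by rw [G.range_inv]
  have k1 := hr.mul ((G.source_mul _ _ e1).trans e3)
    ((G.source_mul _ _ (G.source_inv β)).trans e2)
    (hr.mul e1 (G.source_inv β) (Setoid.refl _) h) (Setoid.refl (G.inv α))
  have l1 : G.mul (G.mul (G.inv β) α e1) (G.inv α) ((G.source_mul _ _ e1).trans e3)
      = G.inv β := by
    rw [G.mul_assoc _ _ _ e1 e3]
    refine (G.mul_congr rfl ((G.mul_inv α).trans ?_) _ (G.range_unit _).symm).trans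
      (G.mul_unit _)
    rw [e1]
  have l2 : G.mul (G.mul (G.inv β) β (G.source_inv β)) (G.inv α)
      ((G.source_mul _ _ (G.source_inv β)).trans e2) = G.inv α := by
    refine (G.mul_congr ((G.inv_mul β).trans ?_) rfl _ (G.source_unit _)).trans
      (G.unit_mul _)
    rw [e2]
  rw [l1, l2] at k1
  exact Setoid.symm k1

section Quot

variable (G : ArrowGroupoid X A) (r : Setoid A) (hr : G.IsCongruence r)

/-- The product of the quotient groupoid, computed on representatives. -/
noncomputable def quotientMul (α β : Quotient r)
    (h : Quotient.lift G.source (fun _ _ => hr.source_eq) α =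
      Quotient.lift G.range (fun _ _ => hr.range_eq) β) : Quotient r :=
  Quotient.mk r (G.mul α.out β.out (by
    rw [← Quotient.out_eq α, ← Quotient.out_eq β] at h
    exact h))

theorem quotientMul_mk (α β : A) (h : G.source α = G.range β) :
    G.quotientMul r hr (Quotient.mk r α) (Quotient.mk r β) h = Quotient.mk r (G.mul α β h) :=
  Quotient.sound (hr.mul _ _ (Quotient.mk_out α) (Quotient.mk_out β))

/-- The quotient of a groupoid by a congruence. -/
noncomputable def quotient : ArrowGroupoid X (Quotient r) where
  source := Quotient.lift G.source (fun _ _ => hr.source_eq)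
  range := Quotient.lift G.range (fun _ _ => hr.range_eq)
  unit x := Quotient.mk r (G.unit x)
  inv := Quotient.map G.inv (fun _ _ => hr.inv)
  mul := G.quotientMul r hr
  source_unit := G.source_unit
  range_unit := G.range_unit
  source_inv := by rintro ⟨α⟩; exact G.source_inv α
  range_inv := by rintro ⟨α⟩; exact G.range_inv α
  source_mul := by
    rintro ⟨α⟩ ⟨β⟩ h
    exact (congrArg _ (G.quotientMul_mk r hr α β h)).trans (G.source_mul α β h)
  range_mul := by
    rintro ⟨α⟩ ⟨β⟩ h
    exact (congrArg _ (G.quotientMul_mk r hr α β h)).trans (G.range_mul α β h)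
  unit_mul := by
    rintro ⟨α⟩
    exact (G.quotientMul_mk r hr _ α _).trans (congrArg _ (G.unit_mul α))
  mul_unit := by
    rintro ⟨α⟩
    exact (G.quotientMul_mk r hr α _ _).trans (congrArg _ (G.mul_unit α))
  mul_assoc := by
    rintro ⟨α⟩ ⟨β⟩ ⟨γ⟩ h k
    have h1 := G.quotientMul_mk r hr α β h
    have h2 := G.quotientMul_mk r hr β γ k
    have h3 := G.quotientMul_mk r hr (G.mul α β h) γ ((G.source_mul α β h).trans k)
    have h4 := G.quotientMul_mk r hr α (G.mul β γ k) (h.trans (G.range_mul β γ k).symm)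
    have h5 := congrArg (Quotient.mk r) (G.mul_assoc α β γ h k)
    have h6 := h3.trans (h5.trans h4.symm)
    simp only [← h1, ← h2] at h6
    exact h6
  inv_mul := by
    rintro ⟨α⟩
    exact (G.quotientMul_mk r hr _ α _).trans (congrArg _ (G.inv_mul α))
  mul_inv := by
    rintro ⟨α⟩
    exact (G.quotientMul_mk r hr α _ _).trans (congrArg _ (G.mul_inv α))

end Quot

/-- A map of arrows, identical on units, that is an isomorphism of topological groupoids. -/
structure IsTopologicalIso {B : Type*} [TopologicalSpace A] [TopologicalSpace B]
    (G : ArrowGroupoid X A) (H : ArrowGroupoid X B) (f : A → B) : Prop where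
  isHomeomorph : IsHomeomorph f
  source_eq : ∀ α, H.source (f α) = G.source α
  range_eq : ∀ α, H.range (f α) = G.range α
  map_mul : ∀ α β (h : G.source α = G.range β),
    f (G.mul α β h) = H.mul (f α) (f β) (by rw [source_eq, range_eq, h])

end ArrowGroupoid

/-! ### The left inverse hull of a left cancellative monoid -/

namespace LCMonoid

open scoped Classical in
/-- The left translation `t ↦ s * t` as a partial bijection, with inverse `s * t ↦ t`. -/
noncomputable def leftTranslation {S : Type*} [Monoid S] [IsLeftCancelMul S] (s : S) : S ≃. S where
  toFun t := some (s * t)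
  invFun u := if h : ∃ t, s * t = u then some h.choose else none
  inv t u := by
    constructor
    · intro h
      split_ifs at h with hu
      have := hu.choose_spec
      simp only [Option.some.injEq] at h
      rw [h] at this
      rw [this]
    · intro h
      simp only [Option.some.injEq] at h
      have hu : ∃ t, s * t = u := ⟨t, h⟩
      rw [dif_pos hu]
      exact congrArg some (mul_left_cancel (hu.choose_spec.trans h.symm))

/-- The partial bijections of `S` generated by the left translations under composition and
inversion. -/
inductive InHull {S : Type*} [Monoid S] [IsLeftCancelMul S] : (S ≃. S) → Prop
  | translation (s : S) : InHull (leftTranslation s)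
  | symm {g : S ≃. S} : InHull g → InHull g.symm
  | trans {g h : S ≃. S} : InHull g → InHull h → InHull (h.trans g)

/-- The left inverse hull of `S`. -/
structure Hull (S : Type*) [Monoid S] [IsLeftCancelMul S] where
  val : S ≃. S
  inHull : InHull val

section Hull

variable {S : Type*} [Monoid S] [IsLeftCancelMul S]

instance : CoeFun (Hull S) (fun _ => S → Option S) := ⟨fun g => g.1⟩

theorem Hull.val_injective {g h : Hull S} (H : g.1 = h.1) : g = h := by
  cases g; cases h; cases H; rfl

@[ext] theorem Hull.ext {g h : Hull S} (H : ∀ s, g s = h s) : g = h :=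
  Hull.val_injective (PEquiv.ext H)

theorem inHull_refl : InHull (PEquiv.refl S) := by
  have : PEquiv.refl S = leftTranslation (1 : S) := by
    ext1 s
    exact congrArg some (one_mul s).symm
  rw [this]
  exact InHull.translation 1

/-- The product `g * h` is the composition "first `h`, then `g`". -/
instance : Monoid (Hull S) where
  mul g h := ⟨h.1.trans g.1, InHull.trans g.2 h.2⟩
  one := ⟨PEquiv.refl S, inHull_refl⟩
  mul_assoc f g h := Hull.val_injective (PEquiv.trans_assoc h.1 g.1 f.1).symm
  one_mul g := Hull.val_injective (PEquiv.trans_refl g.1)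
  mul_one g := Hull.val_injective (PEquiv.refl_trans g.1)

instance : Inv (Hull S) := ⟨fun g => ⟨g.1.symm, InHull.symm g.2⟩⟩

theorem Hull.mul_eq_some {g h : Hull S} {s t : S} :
    (g * h) s = some t ↔ ∃ u, h s = some u ∧ g u = some t :=
  PEquiv.trans_eq_some h.1 g.1 s t

theorem Hull.inv_eq_some {g : Hull S} {s t : S} : g⁻¹ s = some t ↔ g t = some s :=
  PEquiv.eq_some_iff g.1

theorem Hull.one_apply (s : S) : (1 : Hull S) s = some s := rfl

theorem Hull.inj {g : Hull S} {s t u : S} (hs : g s = some u) (ht : g t = some u) : s = t :=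
  PEquiv.inj g.1 hs ht

theorem Hull.ext_some {g h : Hull S} (H : ∀ s t, g s = some t ↔ h s = some t) : g = h :=
  Hull.ext fun s => Option.ext fun t => H s t

/-- The domain of a partial bijection. -/
def Hull.dom (g : Hull S) : Set S := {s | ∃ t, g s = some t}

theorem isIdempotentElem_iff {p : Hull S} :
    IsIdempotentElem p ↔ ∀ s t, p s = some t → s = t := by
  constructor
  · intro hp s t hst
    have h1 : (p * p) s = some t := by rw [hp.eq]; exact hst
    obtain ⟨u, hu, hut⟩ := Hull.mul_eq_some.1 h1
    rw [hst] at hu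
    cases hu
    exact Hull.inj hst hut
  · intro hp
    refine Hull.ext_some fun s t => ?_
    rw [Hull.mul_eq_some]
    constructor
    · rintro ⟨u, hu, hut⟩
      rw [hp _ _ hu]; exact hut
    · intro h
      have := hp _ _ h
      subst this
      exact ⟨s, h, h⟩

end Hull

/-- The semigroup of idempotents of the left inverse hull. -/
structure Idem (S : Type*) [Monoid S] [IsLeftCancelMul S] where
  val : Hull S
  isIdempotentElem : IsIdempotentElem val

section Idem

variable {S : Type*} [Monoid S] [IsLeftCancelMul S]

theorem Idem.eq_some_iff (p : Idem S) {s t : S} : p.1 s = some t ↔ s = t ∧ s ∈ p.1.dom := by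
  constructor
  · intro h
    exact ⟨isIdempotentElem_iff.1 p.2 _ _ h, t, h⟩
  · rintro ⟨rfl, u, hu⟩
    have h := isIdempotentElem_iff.1 p.2 _ _ hu
    subst h
    exact hu

theorem Idem.ext_dom {p q : Idem S} (h : ∀ s, s ∈ p.1.dom ↔ s ∈ q.1.dom) : p = q := by
  have : p.1 = q.1 := Hull.ext_some fun s t => by rw [p.eq_some_iff, q.eq_some_iff, h]
  cases p; cases q; cases this; rfl

instance : Mul (Idem S) where
  mul p q := ⟨p.1 * q.1, isIdempotentElem_iff.2 fun s t h => by
    obtain ⟨u, hu, hut⟩ := Hull.mul_eq_some.1 h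
    exact (q.eq_some_iff.1 hu).1.trans (p.eq_some_iff.1 hut).1⟩

theorem Idem.mem_dom_mul {p q : Idem S} {s : S} :
    s ∈ (p * q).1.dom ↔ s ∈ p.1.dom ∧ s ∈ q.1.dom := by
  constructor
  · rintro ⟨t, ht⟩
    obtain ⟨u, hu, hut⟩ := Hull.mul_eq_some.1 ht
    obtain ⟨rfl, hq⟩ := q.eq_some_iff.1 hu
    exact ⟨⟨t, hut⟩, hq⟩
  · rintro ⟨hp, hq⟩
    exact ⟨s, Hull.mul_eq_some.2 ⟨s, q.eq_some_iff.2 ⟨rfl, hq⟩, p.eq_some_iff.2 ⟨rfl, hp⟩⟩⟩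

/-- The idempotent `g⁻¹ p g`. -/
def Idem.conj (g : Hull S) (p : Idem S) : Idem S :=
  ⟨g⁻¹ * p.1 * g, isIdempotentElem_iff.2 fun s t h => by
    obtain ⟨u, hu, h⟩ := Hull.mul_eq_some.1 h
    obtain ⟨v, hv, h⟩ := Hull.mul_eq_some.1 h
    obtain ⟨rfl, -⟩ := p.eq_some_iff.1 hv
    exact Hull.inj hu (Hull.inv_eq_some.1 h)⟩

theorem Idem.mem_dom_conj {g : Hull S} {p : Idem S} {s : S} :
    s ∈ (p.conj g).1.dom ↔ ∃ t, g s = some t ∧ t ∈ p.1.dom := by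
  constructor
  · rintro ⟨t, h⟩
    obtain ⟨u, hu, h⟩ := Hull.mul_eq_some.1 h
    obtain ⟨v, hv, h⟩ := Hull.mul_eq_some.1 h
    exact ⟨u, hu, v, hv⟩
  · rintro ⟨t, ht, hp⟩
    exact ⟨s, Hull.mul_eq_some.2 ⟨t, ht, Hull.mul_eq_some.2
      ⟨t, p.eq_some_iff.2 ⟨rfl, hp⟩, Hull.inv_eq_some.2 ht⟩⟩⟩

/-- The idempotent `g⁻¹ g`. -/
def Hull.domIdem (g : Hull S) : Idem S :=
  ⟨g⁻¹ * g, isIdempotentElem_iff.2 fun s t h => by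
    obtain ⟨u, hu, h⟩ := Hull.mul_eq_some.1 h
    exact Hull.inj hu (Hull.inv_eq_some.1 h)⟩

theorem Hull.mem_dom_domIdem {g : Hull S} {s : S} : s ∈ g.domIdem.1.dom ↔ s ∈ g.dom := by
  constructor
  · rintro ⟨t, h⟩
    obtain ⟨u, hu, h⟩ := Hull.mul_eq_some.1 h
    exact ⟨u, hu⟩
  · rintro ⟨t, ht⟩
    exact ⟨s, Hull.mul_eq_some.2 ⟨t, ht, Hull.inv_eq_some.2 ht⟩⟩

end Idem

/-! ### Constructible ideals -/

/-- The constructible right ideals `s₁⁻¹ t₁ ⋯ sₙ⁻¹ tₙ S`. -/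
inductive IsConstructible {S : Type*} [Monoid S] : Set S → Prop
  | univ : IsConstructible Set.univ
  | step (s t : S) {X : Set S} : IsConstructible X →
      IsConstructible {u | ∃ x ∈ X, s * u = t * x}

section Constructible

variable {S : Type*} [Monoid S] [IsLeftCancelMul S]

theorem IsConstructible.exists_range {X : Set S} (hX : IsConstructible X) :
    ∃ g : Hull S, ∀ u, u ∈ X ↔ ∃ x, g x = some u := by
  induction hX with
  | univ => exact ⟨1, fun u => ⟨fun _ => ⟨u, rfl⟩, fun _ => trivial⟩⟩
  | step s t _ ih =>
    obtain ⟨g, hg⟩ := ih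
    refine ⟨(Hull.mk _ (InHull.translation s))⁻¹ * (Hull.mk _ (InHull.translation t) * g), fun u => ?_⟩
    constructor
    · rintro ⟨x, hx, h⟩
      obtain ⟨y, hy⟩ := (hg x).1 hx
      refine ⟨y, Hull.mul_eq_some.2 ⟨t * x, Hull.mul_eq_some.2 ⟨x, hy, rfl⟩,
        Hull.inv_eq_some.2 (congrArg some h)⟩⟩
    · rintro ⟨y, hy⟩
      obtain ⟨v, hv, hy⟩ := Hull.mul_eq_some.1 hy
      obtain ⟨x, hx, hv⟩ := Hull.mul_eq_some.1 hv
      have h1 : some (s * u) = some v := Hull.inv_eq_some.1 hy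
      have h2 : some (t * x) = some v := hv
      exact ⟨x, (hg x).2 ⟨y, hx⟩, Option.some.inj (h1.trans h2.symm)⟩

theorem IsConstructible.exists_idem {X : Set S} (hX : IsConstructible X) :
    ∃ p : Idem S, p.1.dom = X := by
  obtain ⟨g, hg⟩ := hX.exists_range
  refine ⟨g⁻¹.domIdem, Set.ext fun u => ?_⟩
  rw [Hull.mem_dom_domIdem, hg]
  exact exists_congr fun x => Hull.inv_eq_some

/-- The idempotent `p_X` of a constructible ideal `X`, that is, the identity map of `X`. -/
noncomputable def idemOf (X : Set S) (hX : IsConstructible X) : Idem S := hX.exists_idem.choose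

theorem dom_idemOf {X : Set S} (hX : IsConstructible X) : (idemOf X hX).1.dom = X :=
  hX.exists_idem.choose_spec

theorem isConstructible_image {g : S ≃. S} (hg : InHull g) :
    ∀ X : Set S, IsConstructible X → IsConstructible {u | ∃ x ∈ X, g x = some u} ∧
      IsConstructible {u | ∃ x ∈ X, g.symm x = some u} := by
  induction hg with
  | translation s =>
    intro X hX
    constructor
    · convert hX.step 1 s using 3 with u
      refine exists_congr fun x => and_congr_right fun _ => ?_
      rw [one_mul, eq_comm (a := u)]
      exact Option.some_inj
    · convert hX.step s 1 using 3 with u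
      refine exists_congr fun x => and_congr_right fun _ => ?_
      rw [one_mul, PEquiv.eq_some_iff]
      exact Option.some_inj
  | symm _ ih =>
    intro X hX
    exact ⟨(ih X hX).2, (ih X hX).1⟩
  | @trans g h _ _ ihg ihh =>
    intro X hX
    constructor
    · convert (ihg _ (ihh X hX).1).1 using 3 with u
      simp only [PEquiv.trans_eq_some, Set.mem_ofPred_eq]
      constructor
      · rintro ⟨x, hx, b, hb, hu⟩; exact ⟨b, ⟨x, hx, hb⟩, hu⟩
      · rintro ⟨b, ⟨x, hx, hb⟩, hu⟩; exact ⟨x, hx, b, hb, hu⟩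
    · convert (ihh _ (ihg X hX).2).2 using 3 with u
      simp only [PEquiv.symm_trans_rev, PEquiv.trans_eq_some, Set.mem_ofPred_eq]
      constructor
      · rintro ⟨x, hx, b, hb, hu⟩; exact ⟨b, ⟨x, hx, hb⟩, hu⟩
      · rintro ⟨b, ⟨x, hx, hb⟩, hu⟩; exact ⟨x, hx, b, hb, hu⟩

theorem Idem.isConstructible_dom (p : Idem S) : IsConstructible p.1.dom := by
  convert (isConstructible_image p.1.2 _ IsConstructible.univ).1 using 1
  ext u
  constructor
  · intro hu
    exact ⟨u, trivial, p.eq_some_iff.2 ⟨rfl, hu⟩⟩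
  · rintro ⟨x, -, hx⟩
    obtain ⟨rfl, hx'⟩ := p.eq_some_iff.1 hx
    exact hx'

theorem idemOf_dom (p : Idem S) : idemOf p.1.dom p.isConstructible_dom = p :=
  Idem.ext_dom fun s => by rw [dom_idemOf]

theorem idemOf_congr {X : Set S} {p : Idem S} (hX : IsConstructible X) (h : p.1.dom = X) :
    idemOf X hX = p :=
  Idem.ext_dom fun s => by rw [dom_idemOf, h]

end Constructible

/-- Finite alignment: every intersection `sS ∩ tS` is a finitely generated right ideal. -/
def FinitelyAligned (S : Type*) [Monoid S] : Prop :=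
  ∀ s t : S, ∃ F : Set S, F.Finite ∧
    {u : S | (∃ v, u = s * v) ∧ ∃ v, u = t * v} = {u : S | ∃ f ∈ F, ∃ v, u = f * v}

/-- Strong C*-regularity. -/
def StronglyCStarRegular (S : Type*) [Monoid S] [IsLeftCancelMul S] : Prop :=
  ∀ (n m : ℕ) (h : Fin n → Hull S) (X : Set S) (X' : Fin m → Set S),
    IsConstructible X → (∀ i, IsConstructible (X' i)) →
    (X \ ⋃ i, X' i).Nonempty →
    X \ ⋃ i, X' i ⊆ ⋃ k, {s | h k s = some s} →
    ∃ (l : ℕ) (Y : Fin l → Set S) (hY : ∀ j, IsConstructible (Y j)) (k : Fin l → Fin n),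
      X \ ⋃ i, X' i ⊆ ⋃ j, Y j ∧
      ∀ j, h (k j) * (idemOf (Y j) (hY j)).1 = (idemOf (Y j) (hY j)).1

/-! ### Semi-characters -/

/-- The semi-characters of the semigroup of idempotents, with `{0, 1}` realized as `Bool`. -/
@[ext] structure SemiChar (S : Type*) [Monoid S] [IsLeftCancelMul S] where
  toFun : Idem S → Bool
  map_mul' : ∀ p q, toFun (p * q) = (toFun p && toFun q)
  ne_zero' : ∃ p, toFun p = true

section SemiChar

variable {S : Type*} [Monoid S] [IsLeftCancelMul S]

instance : CoeFun (SemiChar S) (fun _ => Idem S → Bool) := ⟨SemiChar.toFun⟩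

/-- The topology of pointwise convergence. -/
instance : TopologicalSpace (SemiChar S) := TopologicalSpace.induced SemiChar.toFun inferInstance

theorem SemiChar.mono (χ : SemiChar S) {p q : Idem S} (h : ∀ s, s ∈ p.1.dom → s ∈ q.1.dom)
    (hp : χ p = true) : χ q = true := by
  have : p = p * q := Idem.ext_dom fun s => by
    rw [Idem.mem_dom_mul]; exact ⟨fun hs => ⟨hs, h s hs⟩, fun hs => hs.1⟩
  rw [this, χ.map_mul', Bool.and_eq_true] at hp
  exact hp.2

theorem SemiChar.eq_of_inter (χ : SemiChar S) {p q r : Idem S} (hr : χ r = true)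
    (h : ∀ s ∈ r.1.dom, s ∈ p.1.dom ↔ s ∈ q.1.dom) : χ p = χ q := by
  have : p * r = q * r := Idem.ext_dom fun s => by
    rw [Idem.mem_dom_mul, Idem.mem_dom_mul]
    exact ⟨fun hs => ⟨(h s hs.2).1 hs.1, hs.2⟩, fun hs => ⟨(h s hs.2).2 hs.1, hs.2⟩⟩
  have := congrArg χ.toFun this
  simpa [χ.map_mul', hr] using this

theorem isOpen_eval (p : Idem S) (b : Bool) : IsOpen {χ : SemiChar S | χ p = b} := by
  have hc : Continuous (fun χ : SemiChar S => χ.toFun p) :=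
    (continuous_apply p).comp continuous_induced_dom
  exact (isOpen_discrete {b}).preimage hc

open scoped Classical in
/-- The semi-character `χ_s`, `χ_s(p_X) = 1` if and only if `s ∈ X`. -/
noncomputable def pointChar (s : S) : SemiChar S where
  toFun p := decide (s ∈ p.1.dom)
  map_mul' p q := by
    rw [Bool.eq_iff_iff]
    simp [Idem.mem_dom_mul]
  ne_zero' := ⟨⟨1, isIdempotentElem_iff.2 fun _ _ h => Option.some.inj h⟩,
    decide_eq_true ⟨s, rfl⟩⟩

theorem pointChar_eq_true {s : S} {p : Idem S} : pointChar s p = true ↔ s ∈ p.1.dom :=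
  by classical exact decide_eq_true_iff

theorem pointChar_eq_false {s : S} {p : Idem S} : pointChar s p = false ↔ s ∉ p.1.dom :=
  by classical exact decide_eq_false_iff_not

/-- The closure of the set of semi-characters `χ_s`. -/
def Omega (S : Type*) [Monoid S] [IsLeftCancelMul S] : Set (SemiChar S) :=
  closure (Set.range pointChar)

/-- The semi-character `χ(g⁻¹ · g)`. -/
def SemiChar.act (g : Hull S) (χ : SemiChar S) (h : χ g.domIdem = true) : SemiChar S where
  toFun p := χ (p.conj g)
  map_mul' p q := by
    rw [← χ.map_mul']
    congr 1
    refine Idem.ext_dom fun s => ?_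
    rw [Idem.mem_dom_mul]
    simp only [Idem.mem_dom_conj, Idem.mem_dom_mul]
    constructor
    · rintro ⟨t, ht, h1, h2⟩
      exact ⟨⟨t, ht, h1⟩, t, ht, h2⟩
    · rintro ⟨⟨t, ht, h1⟩, u, hu, h2⟩
      rw [ht] at hu
      cases hu
      exact ⟨t, ht, h1, h2⟩
  ne_zero' := by
    refine ⟨g⁻¹.domIdem, χ.mono (fun s hs => ?_) h⟩
    obtain ⟨t, ht⟩ := Hull.mem_dom_domIdem.1 hs
    exact Idem.mem_dom_conj.2 ⟨t, ht, Hull.mem_dom_domIdem.2 ⟨s, Hull.inv_eq_some.2 ht⟩⟩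

theorem act_mem_Omega {g : Hull S} {χ : SemiChar S} (h : χ g.domIdem = true)
    (hχ : χ ∈ Omega S) : χ.act g h ∈ Omega S := by
  rw [Omega, mem_closure_iff] at hχ ⊢
  intro V hV hmem
  obtain ⟨W, hW, rfl⟩ := isOpen_induced_iff.1 hV
  have hc : Continuous (fun ψ : SemiChar S => fun p : Idem S => ψ.toFun (p.conj g)) :=
    continuous_pi fun p => (continuous_apply (p.conj g)).comp continuous_induced_dom
  obtain ⟨_, ⟨h1, h2⟩, s, rfl⟩ := hχ _ ((hW.preimage hc).inter (isOpen_eval g.domIdem true))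
    ⟨hmem, h⟩
  obtain ⟨t, ht⟩ := Hull.mem_dom_domIdem.1 (pointChar_eq_true.1 h2)
  refine ⟨pointChar t, ?_, t, rfl⟩
  have : (pointChar t).toFun = fun p : Idem S => (pointChar s).toFun (p.conj g) := by
    funext p
    rw [Bool.eq_iff_iff, pointChar_eq_true, pointChar_eq_true, Idem.mem_dom_conj]
    simp [ht]
  rw [Set.mem_preimage, this]
  exact h1

end SemiChar

/-! ### The groupoid of the left inverse hull -/

/-- The set `Σ` of pairs `(g, χ)` with `χ(g⁻¹ g) = 1`. -/
structure PreArrow (S : Type*) [Monoid S] [IsLeftCancelMul S] where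
  elt : Hull S
  char : SemiChar S
  char_dom : char elt.domIdem = true

section Paterson

variable {S : Type*} [Monoid S] [IsLeftCancelMul S]

/-- `(g₁, χ₁) ∼ (g₂, χ₂)` if `χ₁ = χ₂` and `g₁ p = g₂ p` for some idempotent `p` with
`χ₁(p) = 1`. -/
def PreArrow.Rel (a b : PreArrow S) : Prop :=
  a.char = b.char ∧ ∃ p : Idem S, a.elt * p.1 = b.elt * p.1 ∧ a.char p = true

theorem Hull.mul_idem_eq_iff {g h : Hull S} {p : Idem S} :
    g * p.1 = h * p.1 ↔ ∀ s ∈ p.1.dom, g s = h s := by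
  have key : ∀ (g : Hull S) (s t : S),
      (g * p.1) s = some t ↔ s ∈ p.1.dom ∧ g s = some t := by
    intro g s t
    rw [Hull.mul_eq_some]
    constructor
    · rintro ⟨u, hu, hut⟩
      obtain ⟨rfl, hs⟩ := p.eq_some_iff.1 hu
      exact ⟨hs, hut⟩
    · rintro ⟨hs, h⟩
      exact ⟨s, p.eq_some_iff.2 ⟨rfl, hs⟩, h⟩
  constructor
  · intro H s hs
    refine Option.ext fun t => ?_
    have h1 := key g s t
    have h2 := key h s t
    rw [H] at h1
    exact (iff_of_eq (by simp [hs])).trans (h1.symm.trans (h2.trans (by simp [hs])))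
  · intro H
    refine Hull.ext_some fun s t => ?_
    rw [key, key]
    exact and_congr_right fun hs => by rw [H s hs]

instance patersonSetoid (S : Type*) [Monoid S] [IsLeftCancelMul S] : Setoid (PreArrow S) where
  r := PreArrow.Rel
  iseqv :=
    { refl := fun a => ⟨rfl, a.elt.domIdem, rfl, a.char_dom⟩
      symm := by
        rintro a b ⟨h, p, hp, hχ⟩
        exact ⟨h.symm, p, hp.symm, h ▸ hχ⟩
      trans := by
        rintro a b c ⟨h, p, hp, hχ⟩ ⟨h', q, hq, hχ'⟩
        refine ⟨h.trans h', p * q, ?_, ?_⟩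
        · rw [Hull.mul_idem_eq_iff] at *
          intro s hs
          obtain ⟨h1, h2⟩ := Idem.mem_dom_mul.1 hs
          exact (hp s h1).trans (hq s h2)
        · rw [a.char.map_mul', hχ, h, hχ']
          rfl }

/-- The arrows `[g, χ]` of the groupoid of the inverse semigroup `I_ℓ(S)`. -/
def PatersonArrow (S : Type*) [Monoid S] [IsLeftCancelMul S] : Type _ :=
  Quotient (patersonSetoid S)

/-- The arrow `[g, χ]`. -/
def arrow (g : Hull S) (χ : SemiChar S) (h : χ g.domIdem = true) : PatersonArrow S :=
  Quotient.mk (patersonSetoid S) ⟨g, χ, h⟩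

/-- The set `D(g, U)`, for `U` contained in `{χ | χ(g⁻¹ g) = 1}`. -/
def basicSet (g : Hull S) (U : Set (SemiChar S)) : Set (PatersonArrow S) :=
  {γ | ∃ χ ∈ U, ∃ h : χ g.domIdem = true, γ = arrow g χ h}

/-- The topology with basis the sets `D(g, U)`, where `U` is an open subset of
`{χ | χ(g⁻¹ g) = 1}`. -/
instance : TopologicalSpace (PatersonArrow S) :=
  TopologicalSpace.generateFrom
    {V | ∃ (g : Hull S) (U : Set (SemiChar S)),
      IsOpen U ∧ U ⊆ {χ | χ g.domIdem = true} ∧ V = basicSet g U}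

theorem arrow_eq_iff {g h : Hull S} {χ ψ : SemiChar S} {hg : χ g.domIdem = true}
    {hh : ψ h.domIdem = true} :
    arrow g χ hg = arrow h ψ hh ↔
      χ = ψ ∧ ∃ p : Idem S, g * p.1 = h * p.1 ∧ χ p = true :=
  Quotient.eq (r := patersonSetoid S)

theorem act_eq_of_rel {a b : PreArrow S} (h : PreArrow.Rel a b) :
    a.char.act a.elt a.char_dom = b.char.act b.elt b.char_dom := by
  obtain ⟨g, χ, hg⟩ := a
  obtain ⟨g', χ', hg'⟩ := b
  obtain ⟨e, p, hp, hχ⟩ := h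
  dsimp only at e hp hχ
  subst e
  rw [Hull.mul_idem_eq_iff] at hp
  refine SemiChar.ext (funext fun q => ?_)
  refine χ.eq_of_inter hχ fun s hs => ?_
  rw [Idem.mem_dom_conj, Idem.mem_dom_conj, hp s hs]

theorem char_mul_dom {g h : Hull S} {ψ : SemiChar S} (hh : ψ h.domIdem = true)
    (hg : (ψ.act h hh) g.domIdem = true) : ψ (g * h).domIdem = true := by
  refine ψ.mono (p := g.domIdem.conj h) (fun s hs => ?_) hg
  obtain ⟨t, ht, hd⟩ := Idem.mem_dom_conj.1 hs
  obtain ⟨u, hu⟩ := Hull.mem_dom_domIdem.1 hd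
  exact Hull.mem_dom_domIdem.2 ⟨u, Hull.mul_eq_some.2 ⟨t, ht, hu⟩⟩

theorem act_inv_dom {g : Hull S} {χ : SemiChar S} (h : χ g.domIdem = true) :
    (χ.act g h) g⁻¹.domIdem = true := by
  refine χ.mono (fun s hs => ?_) h
  obtain ⟨t, ht⟩ := Hull.mem_dom_domIdem.1 hs
  exact Idem.mem_dom_conj.2 ⟨t, ht, Hull.mem_dom_domIdem.2 ⟨s, Hull.inv_eq_some.2 ht⟩⟩

/-- The source `χ` of `[g, χ]`. -/
def PatersonArrow.source : PatersonArrow S → SemiChar S :=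
  Quotient.lift PreArrow.char fun _ _ h => h.1

/-- The range `χ(g⁻¹ · g)` of `[g, χ]`. -/
def PatersonArrow.range : PatersonArrow S → SemiChar S :=
  Quotient.lift (fun a => a.char.act a.elt a.char_dom) fun _ _ h => act_eq_of_rel h

theorem one_dom (χ : SemiChar S) : χ (1 : Hull S).domIdem = true := by
  obtain ⟨p, hp⟩ := χ.ne_zero'
  exact χ.mono (fun s _ => Hull.mem_dom_domIdem.2 ⟨s, rfl⟩) hp

theorem act_one (χ : SemiChar S) : χ.act 1 (one_dom χ) = χ := by
  refine SemiChar.ext (funext fun p => congrArg χ.toFun (Idem.ext_dom fun s => ?_))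
  rw [Idem.mem_dom_conj]
  simp [Hull.one_apply]

theorem act_mul {g h : Hull S} {ψ : SemiChar S} (hh : ψ h.domIdem = true)
    (hg : (ψ.act h hh) g.domIdem = true) :
    ψ.act (g * h) (char_mul_dom hh hg) = (ψ.act h hh).act g hg := by
  refine SemiChar.ext (funext fun p => congrArg ψ.toFun (Idem.ext_dom fun s => ?_))
  simp only [Idem.mem_dom_conj, Hull.mul_eq_some]
  constructor
  · rintro ⟨t, ⟨u, hu, hut⟩, ht⟩; exact ⟨u, hu, t, hut, ht⟩
  · rintro ⟨u, hu, t, hut, ht⟩; exact ⟨t, ⟨u, hu, hut⟩, ht⟩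

theorem act_inv {g : Hull S} {χ : SemiChar S} (h : χ g.domIdem = true) :
    (χ.act g h).act g⁻¹ (act_inv_dom h) = χ := by
  refine SemiChar.ext (funext fun p => χ.eq_of_inter h fun s hs => ?_)
  obtain ⟨t, ht⟩ := Hull.mem_dom_domIdem.1 hs
  simp only [Idem.mem_dom_conj, ht, Option.some.injEq, Hull.inv_eq_some]
  constructor
  · rintro ⟨_, rfl, u, hu, hp⟩
    rw [Hull.inj ht hu]; exact hp
  · intro hp; exact ⟨t, rfl, s, ht, hp⟩

theorem arrow_congr {g g' : Hull S} {χ χ' : SemiChar S} (hg : g = g') (hχ : χ = χ')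
    (h : χ g.domIdem = true) (h' : χ' g'.domIdem = true) : arrow g χ h = arrow g' χ' h' := by
  subst hg hχ; rfl

/-- The inverse `[g⁻¹, χ(g⁻¹ · g)]` of `[g, χ]`. -/
def PatersonArrow.inv : PatersonArrow S → PatersonArrow S :=
  Quotient.lift (fun a => arrow a.elt⁻¹ (a.char.act a.elt a.char_dom) (act_inv_dom a.char_dom)) (by
    intro a b hab
    refine arrow_eq_iff.2 ⟨act_eq_of_rel hab, ?_⟩
    obtain ⟨h, p, hp, hχ⟩ := hab
    rw [Hull.mul_idem_eq_iff] at hp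
    refine ⟨(p * a.elt.domIdem).conj a.elt⁻¹, ?_, ?_⟩
    · rw [Hull.mul_idem_eq_iff]
      intro s hs
      obtain ⟨t, ht, hd⟩ := Idem.mem_dom_conj.1 hs
      rw [ht]
      symm
      rw [Hull.inv_eq_some] at ht ⊢
      rw [← hp t (Idem.mem_dom_mul.1 hd).1, ht]
    · have h1 : a.char (p * a.elt.domIdem) = true := by
        rw [a.char.map_mul', hχ, a.char_dom]; rfl
      refine a.char.mono (fun s hs => ?_) h1
      obtain ⟨t, ht⟩ := Hull.mem_dom_domIdem.1 (Idem.mem_dom_mul.1 hs).2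
      exact Idem.mem_dom_conj.2 ⟨t, ht, Idem.mem_dom_conj.2 ⟨s, Hull.inv_eq_some.2 ht, hs⟩⟩)

theorem PatersonArrow.composable {a b : PreArrow S}
    (h : a.char = b.char.act b.elt b.char_dom) : b.char (a.elt * b.elt).domIdem = true :=
  char_mul_dom b.char_dom (h ▸ a.char_dom)

/-- The product `[g, χ] [h, ψ] = [gh, ψ]`, defined if `χ = ψ(h⁻¹ · h)`; it is computed on
representatives and does not depend on them by the lemma that follows. -/
noncomputable def PatersonArrow.mul (γ δ : PatersonArrow S) (h : γ.source = δ.range) :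
    PatersonArrow S :=
  arrow (γ.out.elt * δ.out.elt) δ.out.char (PatersonArrow.composable (by
    rw [← Quotient.out_eq γ, ← Quotient.out_eq δ] at h
    exact h))

theorem PatersonArrow.mul_arrow {g k : Hull S} {χ ψ : SemiChar S} (hg : χ g.domIdem = true)
    (hk : ψ k.domIdem = true) (h : χ = ψ.act k hk) :
    PatersonArrow.mul (arrow g χ hg) (arrow k ψ hk) h =
      arrow (g * k) ψ (char_mul_dom hk (h ▸ hg)) := by
  refine arrow_eq_iff.2 ?_
  obtain ⟨e1, p, hp, hpχ⟩ : PreArrow.Rel (Quotient.out (arrow g χ hg)) ⟨g, χ, hg⟩ :=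
    Quotient.mk_out (s := patersonSetoid S) (⟨g, χ, hg⟩ : PreArrow S)
  obtain ⟨e2, q, hq, hqψ⟩ : PreArrow.Rel (Quotient.out (arrow k ψ hk)) ⟨k, ψ, hk⟩ :=
    Quotient.mk_out (s := patersonSetoid S) (⟨k, ψ, hk⟩ : PreArrow S)
  dsimp only at e1 hp hpχ e2 hq hqψ
  rw [e1, h] at hpχ
  rw [e2] at hqψ
  refine ⟨e2, p.conj k * q, ?_, ?_⟩
  · rw [Hull.mul_idem_eq_iff] at *
    intro s hs
    obtain ⟨h1, h2⟩ := Idem.mem_dom_mul.1 hs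
    obtain ⟨t, ht, hd⟩ := Idem.mem_dom_conj.1 h1
    refine Option.ext fun u => ?_
    have := (hq s h2).trans ht
    rw [Hull.mul_eq_some, Hull.mul_eq_some, this, ht]
    simp only [Option.some.injEq, exists_eq_left', hp t hd]
  · have : ψ (p.conj k) = true := hpχ
    rw [e2, ψ.map_mul', this, hqψ]
    rfl

/-- The groupoid of the inverse semigroup `I_ℓ(S)`, with unit space the semi-characters. -/
noncomputable def patersonGroupoid (S : Type*) [Monoid S] [IsLeftCancelMul S] :
    ArrowGroupoid (SemiChar S) (PatersonArrow S) where
  source := PatersonArrow.source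
  range := PatersonArrow.range
  unit χ := arrow 1 χ (one_dom χ)
  inv := PatersonArrow.inv
  mul := PatersonArrow.mul
  source_unit _ := rfl
  range_unit χ := act_one χ
  source_inv := by rintro ⟨a⟩; rfl
  range_inv := by rintro ⟨a⟩; exact act_inv a.char_dom
  source_mul := by
    rintro ⟨g, χ, hg⟩ ⟨k, ψ, hk⟩ h
    exact (congrArg PatersonArrow.source (PatersonArrow.mul_arrow hg hk h)).trans rfl
  range_mul := by
    rintro ⟨g, χ, hg⟩ ⟨k, ψ, hk⟩ h
    refine (congrArg PatersonArrow.range (PatersonArrow.mul_arrow hg hk h)).trans ?_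
    have h' : χ = ψ.act k hk := h
    subst h'
    exact act_mul hk hg
  unit_mul := by
    rintro ⟨g, χ, hg⟩
    exact (PatersonArrow.mul_arrow (one_dom _) hg rfl).trans
      (arrow_congr (one_mul g) rfl _ hg)
  mul_unit := by
    rintro ⟨g, χ, hg⟩
    exact (PatersonArrow.mul_arrow hg (one_dom _) (act_one χ).symm).trans
      (arrow_congr (mul_one g) rfl _ hg)
  mul_assoc := by
    rintro ⟨f, φ, hf⟩ ⟨g, χ, hg⟩ ⟨k, ψ, hk⟩ h1 h2
    have h1' : φ = χ.act g hg := h1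
    have h2' : χ = ψ.act k hk := h2
    subst h1' h2'
    have a1 := PatersonArrow.mul_arrow hf hg rfl
    have a2 := PatersonArrow.mul_arrow hg hk rfl
    have a3 := PatersonArrow.mul_arrow (char_mul_dom hg hf) hk rfl
    have a4 := PatersonArrow.mul_arrow hf (char_mul_dom hk hg) (act_mul hk hg).symm
    have a5 := a3.trans ((arrow_congr (mul_assoc f g k) rfl _ _).trans a4.symm)
    simp only [← a1, ← a2] at a5
    exact a5
  inv_mul := by
    rintro ⟨g, χ, hg⟩
    refine (PatersonArrow.mul_arrow (act_inv_dom hg) hg rfl).trans ?_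
    refine arrow_eq_iff.2 ⟨rfl, g.domIdem, ?_, hg⟩
    rw [one_mul]
    exact g.domIdem.2
  mul_inv := by
    rintro ⟨g, χ, hg⟩
    refine (PatersonArrow.mul_arrow hg (act_inv_dom hg) (act_inv hg).symm).trans ?_
    refine arrow_eq_iff.2 ⟨rfl, g⁻¹.domIdem, ?_, act_inv_dom hg⟩
    rw [one_mul]
    exact g⁻¹.domIdem.2

theorem range_mem_Omega (γ : PatersonArrow S) (h : γ.source ∈ Omega S) : γ.range ∈ Omega S := by
  obtain ⟨g, χ, hg⟩ := γ
  exact act_mem_Omega hg h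

end Paterson

/-! ### The groupoids `𝒢_P(S)` and `𝒢(S)` -/

/-- The arrows of `𝒢_P(S)`, the restriction to the closed invariant set `Ω(S)`, with the subspace
topology. -/
abbrev GPArrow (S : Type*) [Monoid S] [IsLeftCancelMul S] : Type _ :=
  {γ : PatersonArrow S // (patersonGroupoid S).source γ ∈ Omega S}

/-- The groupoid `𝒢_P(S)`. -/
noncomputable def groupoidP (S : Type*) [Monoid S] [IsLeftCancelMul S] :
    ArrowGroupoid (Omega S) (GPArrow S) :=
  (patersonGroupoid S).restrict (Omega S) range_mem_Omega

section Spielberg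

variable {S : Type*} [Monoid S] [IsLeftCancelMul S]

/-- The extension of a semi-character to sets of the form `Y = X \ (X₁ ∪ ⋯ ∪ X_m)` with
constructible `X`, `X_i` takes the value one at `Y`. -/
def SemiChar.IsOneAt (χ : SemiChar S) (Y : Set S) : Prop :=
  ∃ (X : Set S) (hX : IsConstructible X) (F : Set (Set S)) (hF : ∀ Z ∈ F, IsConstructible Z),
    F.Finite ∧ Y = X \ ⋃₀ F ∧ χ (idemOf X hX) = true ∧
      ∀ (Z : Set S) (hZ : Z ∈ F), χ (idemOf Z (hF Z hZ)) = false

theorem SemiChar.isOneAt_dom (χ : SemiChar S) {p : Idem S} (hp : χ p = true) :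
    χ.IsOneAt p.1.dom :=
  ⟨p.1.dom, p.isConstructible_dom, ∅, by simp, Set.finite_empty, by simp,
    by rw [idemOf_dom]; exact hp, by simp⟩

theorem SemiChar.IsOneAt.inter {χ : SemiChar S} {Y Z : Set S} (hY : χ.IsOneAt Y)
    (hZ : χ.IsOneAt Z) : χ.IsOneAt (Y ∩ Z) := by
  obtain ⟨X, hX, F, hF, fF, rfl, h1, h2⟩ := hY
  obtain ⟨X', hX', F', hF', fF', rfl, h1', h2'⟩ := hZ
  have hd : (idemOf X hX * idemOf X' hX').1.dom = X ∩ X' := by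
    ext s; rw [Idem.mem_dom_mul, dom_idemOf, dom_idemOf]; rfl
  refine ⟨X ∩ X', hd ▸ Idem.isConstructible_dom _, F ∪ F',
    fun W hW => hW.elim (hF W) (hF' W), fF.union fF', ?_, ?_, ?_⟩
  · ext s
    simp only [Set.mem_inter_iff, Set.mem_sdiff, Set.sUnion_union, Set.mem_union]
    tauto
  · rw [idemOf_congr _ hd, χ.map_mul', h1, h1']; rfl
  · rintro W (hW | hW)
    · exact h2 W hW
    · exact h2' W hW

theorem SemiChar.IsOneAt.preimage {χ : SemiChar S} {g : Hull S} {hg : χ g.domIdem = true}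
    {Y : Set S} (hY : (χ.act g hg).IsOneAt Y) :
    χ.IsOneAt {s | ∃ t ∈ Y, g s = some t} := by
  obtain ⟨X, hX, F, hF, fF, rfl, h1, h2⟩ := hY
  have hd : ∀ (Z : Set S) (hZ : IsConstructible Z),
      ((idemOf Z hZ).conj g).1.dom = {s | ∃ t ∈ Z, g s = some t} := by
    intro Z hZ
    ext s
    rw [Idem.mem_dom_conj, dom_idemOf]
    exact exists_congr fun t => and_comm
  refine ⟨{s | ∃ t ∈ X, g s = some t}, hd X hX ▸ Idem.isConstructible_dom _,
    (fun Z => {s | ∃ t ∈ Z, g s = some t}) '' F, ?_, fF.image _, ?_, ?_, ?_⟩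
  · rintro _ ⟨Z, hZ, rfl⟩
    have h3 := Idem.isConstructible_dom ((idemOf Z (hF Z hZ)).conj g)
    rw [hd Z (hF Z hZ)] at h3
    exact h3
  · ext s
    simp only [Set.mem_sdiff, Set.mem_ofPred_eq, Set.mem_sUnion, Set.mem_image]
    constructor
    · rintro ⟨t, ⟨hX, hF⟩, ht⟩
      refine ⟨⟨t, hX, ht⟩, ?_⟩
      rintro ⟨_, ⟨Z, hZ, rfl⟩, u, hu, hsu⟩
      rw [ht] at hsu
      cases hsu
      exact hF ⟨Z, hZ, hu⟩
    · rintro ⟨⟨t, hX, ht⟩, hF⟩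
      exact ⟨t, ⟨hX, fun ⟨Z, hZ, hu⟩ => hF ⟨_, ⟨Z, hZ, rfl⟩, t, hu, ht⟩⟩, ht⟩
  · rw [idemOf_congr _ (hd X hX)]
    exact h1
  · rintro _ ⟨Z, hZ, rfl⟩
    rw [idemOf_congr _ (hd Z (hF Z hZ))]
    exact h2 Z hZ

theorem SemiChar.IsOneAt.isOpen_exists {χ : SemiChar S} {Y : Set S} (hY : χ.IsOneAt Y) :
    ∃ U : Set (SemiChar S), IsOpen U ∧ χ ∈ U ∧ ∀ s, pointChar s ∈ U → s ∈ Y := by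
  obtain ⟨X, hX, F, hF, fF, rfl, h1, h2⟩ := hY
  refine ⟨{ψ | ψ (idemOf X hX) = true} ∩
    ⋂ Z ∈ F, {ψ | ∃ hZ : IsConstructible Z, ψ (idemOf Z hZ) = false}, ?_, ⟨h1, ?_⟩, ?_⟩
  · refine (isOpen_eval _ _).inter (fF.isOpen_biInter fun Z hZ => ?_)
    convert isOpen_eval (idemOf Z (hF Z hZ)) false using 3
    exact ⟨fun ⟨_, h⟩ => h, fun h => ⟨_, h⟩⟩
  · simp only [Set.mem_iInter]
    exact fun Z hZ => ⟨hF Z hZ, h2 Z hZ⟩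
  · rintro s ⟨h3, h4⟩
    simp only [Set.mem_iInter] at h4
    have := pointChar_eq_true.1 h3
    rw [dom_idemOf] at this
    refine ⟨this, ?_⟩
    rintro ⟨Z, hZ, hs⟩
    obtain ⟨hc, h5⟩ := h4 Z hZ
    have := pointChar_eq_false.1 h5
    rw [dom_idemOf] at this
    exact this hs

/-- `[g, χ] ∼ [h, χ]` if `g` and `h` coincide on a set `Y = X \ (X₁ ∪ ⋯ ∪ X_m)`, with constructible
`X`, `X_i`, such that `χ(p_Y) = 1`. -/
def PatersonArrow.Sim (γ δ : PatersonArrow S) : Prop :=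
  ∃ (χ : SemiChar S) (g h : Hull S) (hg : χ g.domIdem = true) (hh : χ h.domIdem = true),
    γ = arrow g χ hg ∧ δ = arrow h χ hh ∧ ∃ Y : Set S, χ.IsOneAt Y ∧ ∀ s ∈ Y, g s = h s

theorem PatersonArrow.sim_arrow {g h : Hull S} {χ ψ : SemiChar S} {hg : χ g.domIdem = true}
    {hh : ψ h.domIdem = true} : PatersonArrow.Sim (arrow g χ hg) (arrow h ψ hh) ↔
      χ = ψ ∧ ∃ Y : Set S, χ.IsOneAt Y ∧ ∀ s ∈ Y, g s = h s := by
  constructor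
  · rintro ⟨φ, g', h', hg', hh', e1, e2, Y, hY, H⟩
    obtain ⟨rfl, p, hp, hpχ⟩ := arrow_eq_iff.1 e1
    obtain ⟨rfl, q, hq, hqχ⟩ := arrow_eq_iff.1 e2
    rw [Hull.mul_idem_eq_iff] at hp hq
    refine ⟨rfl, _, (hY.inter (SemiChar.isOneAt_dom _ hpχ)).inter (SemiChar.isOneAt_dom _ hqχ), ?_⟩
    rintro s ⟨⟨h1, h2⟩, h3⟩
    rw [hp s h2, hq s h3, H s h1]
  · rintro ⟨rfl, Y, hY, H⟩
    exact ⟨χ, g, h, hg, hh, rfl, rfl, Y, hY, H⟩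

/-- The relation `∼` on `𝒢_P(S)`. -/
def simSetoid (S : Type*) [Monoid S] [IsLeftCancelMul S] : Setoid (GPArrow S) where
  r γ δ := PatersonArrow.Sim γ.1 δ.1
  iseqv :=
    { refl := by
        rintro ⟨⟨g, χ, hg⟩, h⟩
        exact PatersonArrow.sim_arrow.2 ⟨rfl, _, SemiChar.isOneAt_dom _ hg, fun _ _ => rfl⟩
      symm := by
        rintro γ δ ⟨χ, g, h, hg, hh, e1, e2, Y, hY, H⟩
        exact ⟨χ, h, g, hh, hg, e2, e1, Y, hY, fun s hs => (H s hs).symm⟩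
      trans := by
        rintro ⟨⟨g, χ, hg⟩, h1⟩ ⟨⟨k, ψ, hk⟩, h2⟩ ⟨⟨l, φ, hl⟩, h3⟩ h12 h23
        obtain ⟨rfl, Y, hY, H⟩ := PatersonArrow.sim_arrow.1 h12
        obtain ⟨rfl, Z, hZ, K⟩ := PatersonArrow.sim_arrow.1 h23
        exact PatersonArrow.sim_arrow.2 ⟨rfl, _, hY.inter hZ,
          fun s hs => (H s hs.1).trans (K s hs.2)⟩ }

theorem act_eq_of_isOneAt {g h : Hull S} {χ : SemiChar S} (hχ : χ ∈ Omega S)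
    (hg : χ g.domIdem = true) (hh : χ h.domIdem = true) {Y : Set S} (hY : χ.IsOneAt Y)
    (H : ∀ s ∈ Y, g s = h s) : χ.act g hg = χ.act h hh := by
  refine SemiChar.ext (funext fun p => ?_)
  change χ (p.conj g) = χ (p.conj h)
  obtain ⟨U, hU, hχU, hUY⟩ := hY.isOpen_exists
  obtain ⟨_, ⟨⟨h1, h2⟩, h3⟩, s, rfl⟩ := mem_closure_iff.1 hχ _
    ((hU.inter (isOpen_eval (p.conj g) (χ (p.conj g)))).inter
      (isOpen_eval (p.conj h) (χ (p.conj h)))) ⟨⟨hχU, rfl⟩, rfl⟩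
  have hs := H s (hUY s h1)
  have h2' : pointChar s (p.conj g) = χ (p.conj g) := h2
  have h3' : pointChar s (p.conj h) = χ (p.conj h) := h3
  rw [← h2', ← h3', Bool.eq_iff_iff, pointChar_eq_true, pointChar_eq_true,
    Idem.mem_dom_conj, Idem.mem_dom_conj, hs]

theorem sim_isCongruence (S : Type*) [Monoid S] [IsLeftCancelMul S] :
    (groupoidP S).IsCongruence (simSetoid S) where
  source_eq := by
    rintro ⟨⟨g, χ, hg⟩, h1⟩ ⟨⟨k, ψ, hk⟩, h2⟩ h
    exact Subtype.ext (PatersonArrow.sim_arrow.1 h).1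
  range_eq := by
    rintro ⟨⟨g, χ, hg⟩, h1⟩ ⟨⟨k, ψ, hk⟩, h2⟩ h
    obtain ⟨rfl, Y, hY, H⟩ := PatersonArrow.sim_arrow.1 h
    exact Subtype.ext (act_eq_of_isOneAt h1 hg hk hY H)
  mul := by
    rintro ⟨⟨g, χ, hg⟩, h1⟩ ⟨⟨g', χ', hg'⟩, h1'⟩ ⟨⟨k, ψ, hk⟩, h2⟩ ⟨⟨k', ψ', hk'⟩, h2'⟩ h h' hα hβ
    obtain ⟨rfl, Y, hY, H⟩ := PatersonArrow.sim_arrow.1 hα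
    obtain ⟨rfl, Z, hZ, K⟩ := PatersonArrow.sim_arrow.1 hβ
    have e : χ = ψ.act k hk := congrArg Subtype.val h
    have e' : χ = ψ.act k' hk' := congrArg Subtype.val h'
    change PatersonArrow.Sim (PatersonArrow.mul (arrow g χ hg) (arrow k ψ hk) e)
      (PatersonArrow.mul (arrow g' χ hg') (arrow k' ψ hk') e')
    rw [PatersonArrow.mul_arrow, PatersonArrow.mul_arrow, PatersonArrow.sim_arrow]
    rw [e] at hY
    refine ⟨rfl, _, hY.preimage.inter hZ, ?_⟩
    rintro s ⟨⟨t, ht, hst⟩, hs⟩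
    have hst' := (K s hs).symm.trans hst
    refine Option.ext fun u => ?_
    rw [Hull.mul_eq_some, Hull.mul_eq_some, hst, hst']
    simp only [Option.some.injEq, exists_eq_left', H t ht]

end Spielberg

/-- The arrows of `𝒢(S) = 𝒢_P(S)/∼`, with the quotient topology. -/
abbrev GArrow (S : Type*) [Monoid S] [IsLeftCancelMul S] : Type _ := Quotient (simSetoid S)

/-- The groupoid `𝒢(S)`. -/
noncomputable def groupoid (S : Type*) [Monoid S] [IsLeftCancelMul S] :
    ArrowGroupoid (Omega S) (GArrow S) :=
  (groupoidP S).quotient (simSetoid S) (sim_isCongruence S)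

/-- The canonical map `𝒢_P(S) → 𝒢(S)`. -/
def canonicalMap (S : Type*) [Monoid S] [IsLeftCancelMul S] : GPArrow S → GArrow S :=
  Quotient.mk (simSetoid S)

/-! ### The monoid -/

/-- The generators `a`, `b`, `x_n`, `y_n`, `n ∈ ℤ`. -/
inductive Gen : Type
  | a : Gen
  | b : Gen
  | x (n : ℤ) : Gen
  | y (n : ℤ) : Gen

open FreeMonoid in
/-- The relations `a b x_n = b x_n` and `a b y_n = b y_{n+1}`, `n ∈ ℤ`. -/
inductive GenRel : FreeMonoid Gen → FreeMonoid Gen → Prop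
  | x (n : ℤ) : GenRel (of Gen.a * of Gen.b * of (Gen.x n)) (of Gen.b * of (Gen.x n))
  | y (n : ℤ) : GenRel (of Gen.a * of Gen.b * of (Gen.y n)) (of Gen.b * of (Gen.y (n + 1)))

/-- The monoid `⟨a, b, x_n, y_n : a b x_n = b x_n, a b y_n = b y_{n+1}⟩`. -/
abbrev ExampleMonoid : Type := PresentedMonoid GenRel

end LCMonoid

/-! Write `c` for any of the letters `x_n`, `y_n`, and `c'` for `x_n`, `y_{n+1}` respectively, so
that the relations read `a b c = b c'`. The words reduced for `a b c → b c'` are normal forms, and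
every generator acts injectively on them; hence `S` is left cancellative, and a letter `c` at the
beginning of an element is determined by that element.

Let `D` be the right ideal generated by all `x_n` and `y_n`. Every nonempty element of `I_ℓ(S)` is
of the form `t σ s⁻¹`, where `σ` is the identity of `S` or a map `x_n z ↦ x_n z`,
`y_n z ↦ y_{n+k} z` of `D`, so every nonempty constructible ideal is `tS` or `tD`. One that contains
two of the letters `c` contains `D`. If `D` minus finitely many constructible ideals is nonempty, it
therefore contains almost all `y_n`; if it is covered by the fixed point sets of finitely many
elements of `I_ℓ(S)`, then by the pigeonhole principle one of these elements fixes two of the `y_n`,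
and such an element is the identity on `D`. This is strong C*-regularity in the essential case.

The ideal `aS ∩ bS = bD` is not finitely generated. The points `x_n` converge to the character of
the ideals containing `D`. The element `b⁻¹ a b` fixes every `x_n` but no `y_n`, so at this limit it
defines an arrow that is different from the unit and cannot be separated from it.
-/

namespace LCMonoid

open scoped SetRel

section Ideals

variable {S : Type*} [Monoid S]

theorem IsConstructible.mul_mem {X : Set S} (hX : IsConstructible X) {u : S} (hu : u ∈ X) (z : S) :
    u * z ∈ X := by
  induction hX generalizing u with
  | univ => trivial
  | step s t _ ih =>
    obtain ⟨x, hx, h⟩ := hu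
    exact ⟨x * z, ih hx, by rw [← mul_assoc, h, mul_assoc]⟩

theorem IsConstructible.preimage_mul_left {X : Set S} (hX : IsConstructible X) (t : S) :
    IsConstructible ((t * ·) ⁻¹' X) := by
  convert hX.step t 1 using 1
  ext u
  simp

theorem isConstructible_range_mul_left (t : S) : IsConstructible (Set.range (t * ·)) := by
  convert IsConstructible.univ.step 1 t using 1
  ext u
  simp [eq_comm]

end Ideals

section Hull

variable {S : Type*} [Monoid S] [IsLeftCancelMul S]

namespace Hull

/-- The left translation `t ↦ s * t`, as an element of the left inverse hull. -/
noncomputable def translation (s : S) : Hull S := ⟨leftTranslation s, .translation s⟩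

theorem translation_eq_some {s u v : S} : translation s u = some v ↔ s * u = v :=
  Option.some_inj

theorem translation_one : translation (1 : S) = 1 :=
  ext fun u => congrArg some (one_mul u)

theorem translation_mul (s t : S) : translation (s * t) = translation s * translation t :=
  ext_some fun u v => by simp [mul_eq_some, translation_eq_some, mul_assoc]

theorem inv_inv (g : Hull S) : g⁻¹⁻¹ = g :=
  val_injective g.1.symm_symm

theorem inv_one : (1 : Hull S)⁻¹ = 1 :=
  val_injective PEquiv.symm_refl

theorem mul_inv_rev (g h : Hull S) : (g * h)⁻¹ = h⁻¹ * g⁻¹ :=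
  val_injective (PEquiv.symm_trans_rev h.1 g.1)

theorem translation_inv_mul_mul_eq_some {t u v : S} {g : Hull S} :
    ((translation t)⁻¹ * g * translation t) u = some v ↔ g (t * u) = some (t * v) := by
  simp [mul_eq_some, inv_eq_some, translation_eq_some]

theorem apply_mul (g : Hull S) {u v : S} (h : g u = some v) (z : S) :
    g (u * z) = some (v * z) := by
  obtain ⟨g, hg⟩ := g
  induction hg generalizing u v with
  | translation s =>
    rw [← translation_eq_some.1 h, mul_assoc]
    rfl
  | symm _ ih =>
    rw [PEquiv.eq_some_iff] at h ⊢
    exact ih h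
  | trans _ _ ihg ihh =>
    rw [PEquiv.trans_eq_some] at h ⊢
    obtain ⟨w, hw, hv⟩ := h
    exact ⟨w * z, ihh hw, ihg hv⟩

theorem induction_left {C : Set S} (hC : Submonoid.closure C = ⊤) {P : Hull S → Prop} (one : P 1)
    (mul : ∀ c ∈ C, ∀ g, P g → P (translation c * g))
    (inv_mul : ∀ c ∈ C, ∀ g, P g → P ((translation c)⁻¹ * g)) (g : Hull S) : P g := by
  suffices H : ∀ k, P k → P (g * k) ∧ P (g⁻¹ * k) by simpa only [mul_one] using (H 1 one).1
  obtain ⟨g, hg⟩ := g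
  induction hg with
  | translation s =>
    change ∀ k, P k → P (translation s * k) ∧ P ((translation s)⁻¹ * k)
    induction hC ▸ Submonoid.mem_top s using Submonoid.closure_induction with
    | mem c hc => exact fun k hk => ⟨mul c hc k hk, inv_mul c hc k hk⟩
    | one =>
      intro k hk
      simpa only [translation_one, inv_one, one_mul, and_self] using hk
    | mul s t _ _ ihs iht =>
      intro k hk
      rw [translation_mul, mul_inv_rev, mul_assoc, mul_assoc]
      exact ⟨(ihs _ (iht k hk).1).1, (iht _ (ihs k hk).2).2⟩
  | @symm g hg ih =>
    intro k hk
    exact ⟨(ih k hk).2, (inv_inv ⟨g, hg⟩).symm ▸ (ih k hk).1⟩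
  | @trans g h hg hh ihg ihh =>
    intro k hk
    change P (⟨g, hg⟩ * ⟨h, hh⟩ * k) ∧ P ((⟨g, hg⟩ * ⟨h, hh⟩)⁻¹ * k)
    rw [mul_inv_rev, mul_assoc, mul_assoc]
    exact ⟨(ihg _ (ihh k hk).1).1, (ihh _ (ihg k hk).2).2⟩

end Hull

theorem mul_idemOf_eq_iff {g : Hull S} {Y : Set S} (hY : IsConstructible Y) :
    g * (idemOf Y hY).1 = (idemOf Y hY).1 ↔ ∀ s ∈ Y, g s = some s := by
  have h := Hull.mul_idem_eq_iff (g := g) (h := 1) (p := idemOf Y hY)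
  rwa [one_mul, dom_idemOf] at h

end Hull

section CanonicalMap

variable {S : Type*} [Monoid S] [IsLeftCancelMul S] {χ : SemiChar S}

theorem SemiChar.IsOneAt.exists_eq_true_of_subset_iUnion {ι : Type*} [Finite ι] {Y : Set S}
    (hY : χ.IsOneAt Y) (hχ : χ ∈ Omega S) {p : ι → Idem S} (hp : Y ⊆ ⋃ i, (p i).1.dom) :
    ∃ i, χ (p i) = true := by
  by_contra! h
  obtain ⟨U, hU, hχU, hUY⟩ := hY.isOpen_exists
  obtain ⟨_, ⟨hsU, hsp⟩, s, rfl⟩ := mem_closure_iff.1 hχ (U ∩ ⋂ i, {ψ | ψ (p i) = false})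
    (hU.inter (isOpen_iInter_of_finite fun i => isOpen_eval _ _))
    ⟨hχU, Set.mem_iInter.2 fun i => eq_false_of_ne_true (h i)⟩
  obtain ⟨i, hi⟩ := Set.mem_iUnion.1 (hp (hUY s hsU))
  exact pointChar_eq_false.1 (Set.mem_iInter.1 hsp i) hi

theorem SemiChar.IsOneAt.nonempty {Y : Set S} (hY : χ.IsOneAt Y) (hχ : χ ∈ Omega S) :
    Y.Nonempty := by
  by_contra h
  have hsub : Y ⊆ ⋃ i : Empty, (i.elim : Idem S).1.dom := by
    simp [Set.not_nonempty_iff_eq_empty.1 h]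
  exact (hY.exists_eq_true_of_subset_iUnion hχ hsub).choose.elim

theorem StronglyCStarRegular.exists_mul_idem_eq (hS : StronglyCStarRegular S) (hχ : χ ∈ Omega S)
    {f : Hull S} {Y : Set S} (hY : χ.IsOneAt Y) (hf : ∀ s ∈ Y, f s = some s) :
    ∃ p : Idem S, f * p.1 = p.1 ∧ χ p = true := by
  have hne := hY.nonempty hχ
  obtain ⟨X, hX, F, hF, fF, rfl, -, -⟩ := id hY
  obtain ⟨m, X', -, rfl⟩ := fF.fin_param
  rw [Set.sUnion_range] at hY hf hne
  obtain ⟨l, Z, hZ, -, hcov, hfix⟩ := hS 1 m (fun _ => f) X X' hX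
    (fun i => hF _ (Set.mem_range_self i)) hne fun s hs => Set.mem_iUnion.2 ⟨0, hf s hs⟩
  obtain ⟨j, hj⟩ := hY.exists_eq_true_of_subset_iUnion hχ (p := fun j => idemOf (Z j) (hZ j))
    (by simpa only [dom_idemOf] using hcov)
  exact ⟨_, hfix j, hj⟩

theorem StronglyCStarRegular.canonicalMap_injective (hS : StronglyCStarRegular S) :
    Function.Injective (canonicalMap S) := by
  rintro ⟨⟨g, χ, hg⟩, hχ⟩ ⟨⟨k, ψ, hk⟩, _⟩ h
  obtain ⟨rfl, Y, hY, hgk⟩ := PatersonArrow.sim_arrow.1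
    (Quotient.exact h : PatersonArrow.Sim (arrow g χ hg) (arrow k ψ hk))
  have hfix : ∀ s ∈ Y ∩ g.domIdem.1.dom, (g⁻¹ * k) s = some s := by
    rintro s ⟨hs, hsg⟩
    obtain ⟨t, ht⟩ := Hull.mem_dom_domIdem.1 hsg
    exact Hull.mul_eq_some.2 ⟨t, hgk s hs ▸ ht, Hull.inv_eq_some.2 ht⟩
  obtain ⟨p, hp, hχp⟩ := hS.exists_mul_idem_eq hχ (hY.inter (χ.isOneAt_dom hg)) hfix
  refine Subtype.ext (arrow_eq_iff.2 ⟨rfl, p, Hull.mul_idem_eq_iff.2 fun s hs => ?_, hχp⟩)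
  have hs' : (g⁻¹ * k) s = some s :=
    Hull.mul_idem_eq_iff.1 (hp.trans (one_mul p.1).symm) s hs
  obtain ⟨t, hkt, hgt⟩ := Hull.mul_eq_some.1 hs'
  rw [hkt, Hull.inv_eq_some.1 hgt]

theorem isHomeomorph_canonicalMap (h : Function.Injective (canonicalMap S)) :
    IsHomeomorph (canonicalMap S) :=
  isHomeomorph_iff_isQuotientMap_injective.2 ⟨isQuotientMap_quotient_mk', h⟩

theorem isTopologicalIso_canonicalMap (h : Function.Injective (canonicalMap S)) :
    ArrowGroupoid.IsTopologicalIso (groupoidP S) (groupoid S) (canonicalMap S) where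
  isHomeomorph := isHomeomorph_canonicalMap h
  source_eq _ := rfl
  range_eq _ := rfl
  map_mul α β h :=
    ((groupoidP S).quotientMul_mk (simSetoid S) (sim_isCongruence S) α β h).symm

end CanonicalMap

section Topology

open Filter Topology

variable {S : Type*} [Monoid S] [IsLeftCancelMul S]

theorem continuous_arrow (g : Hull S) :
    Continuous fun χ : {χ : SemiChar S // χ g.domIdem = true} => arrow g χ.1 χ.2 := by
  refine continuous_generateFrom_iff.2 ?_
  rintro _ ⟨k, U, hU, hUk, rfl⟩
  have hpre : (fun χ : {χ : SemiChar S // χ g.domIdem = true} => arrow g χ.1 χ.2) ⁻¹'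
      basicSet k U =
        Subtype.val ⁻¹' (U ∩ ⋃ p : {p : Idem S // g * p.1 = k * p.1}, {χ | χ p.1 = true}) := by
    ext ⟨χ, hχ⟩
    simp only [Set.mem_preimage, basicSet, Set.mem_inter_iff, Set.mem_iUnion, Set.mem_ofPred_eq]
    constructor
    · rintro ⟨ψ, hψ, hk, h⟩
      obtain ⟨rfl, p, hp, hpχ⟩ := arrow_eq_iff.1 h
      exact ⟨hψ, ⟨p, hp⟩, hpχ⟩
    · rintro ⟨hψ, ⟨p, hp⟩, hpχ⟩
      exact ⟨χ, hψ, hUk hψ, arrow_eq_iff.2 ⟨rfl, p, hp, hpχ⟩⟩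
  rw [hpre]
  exact (hU.inter (isOpen_iUnion fun p => isOpen_eval _ _)).preimage continuous_subtype_val

theorem arrow_pointChar_eq_arrow_one {g : Hull S} {s : S} (hs : g s = some s)
    (hg : pointChar s g.domIdem = true) :
    arrow g (pointChar s) hg = arrow 1 (pointChar s) (one_dom _) := by
  have hsS := isConstructible_range_mul_left s
  refine arrow_eq_iff.2 ⟨rfl, idemOf _ hsS, ?_, ?_⟩
  · rw [one_mul, mul_idemOf_eq_iff]
    rintro _ ⟨z, rfl⟩
    exact g.apply_mul hs z
  · rw [pointChar_eq_true, dom_idemOf]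
    exact ⟨1, mul_one s⟩

theorem exists_mul_idem_eq_of_t2Space [T2Space (GPArrow S)] {g : Hull S} {χ : SemiChar S}
    (hχ : χ ∈ closure (pointChar '' {s | g s = some s})) :
    ∃ p : Idem S, g * p.1 = p.1 ∧ χ p = true := by
  set A := pointChar '' {s | g s = some s}
  have hΩ : closure A ⊆ Omega S := closure_mono (Set.image_subset_range _ _)
  have hdom : closure A ⊆ {ψ | ψ g.domIdem = true} := by
    have hclosed : IsClosed {ψ : SemiChar S | ψ g.domIdem = true} := by
      simpa only [isOpen_compl_iff, Set.compl_ofPred, Bool.not_eq_false] using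
        (isOpen_eval g.domIdem false).isClosed_compl
    refine closure_minimal ?_ hclosed
    rintro _ ⟨s, hs, rfl⟩
    exact pointChar_eq_true.2 (Hull.mem_dom_domIdem.2 ⟨s, hs⟩)
  let γ (k : Hull S) (hk : ∀ ψ : closure A, ψ.1 k.domIdem = true) (ψ : closure A) : GPArrow S :=
    ⟨arrow k ψ.1 (hk ψ), hΩ ψ.2⟩
  have hγ (k : Hull S) (hk) : Continuous (γ k hk) :=
    ((continuous_arrow k).comp (continuous_subtype_val.subtype_mk hk)).subtype_mk _
  have hdense : Dense ((↑) ⁻¹' A : Set (closure A)) := by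
    rw [Subtype.dense_iff, Subtype.image_preimage_coe, Set.inter_eq_right.2 subset_closure]
  have hagree : γ g (fun ψ => hdom ψ.2) = γ 1 (fun ψ => one_dom ψ.1) := by
    refine (hγ g _).ext_on hdense (hγ 1 _) ?_
    rintro ⟨_, hψ⟩ ⟨s, hs, rfl⟩
    exact Subtype.ext (arrow_pointChar_eq_arrow_one hs (hdom hψ))
  obtain ⟨-, p, hp, hχp⟩ := arrow_eq_iff.1 (congrArg Subtype.val (congrFun hagree ⟨χ, hχ⟩))
  exact ⟨p, by rw [hp, one_mul], hχp⟩

open scoped Classical in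
/-- The semi-character `χ` with `χ(p_X) = 1` if and only if `D ⊆ X`, i.e. the one given by the
filter of constructible ideals containing `D`. -/
noncomputable def containsChar (D : Set S) : SemiChar S where
  toFun p := decide (D ⊆ p.1.dom)
  map_mul' p q := by
    have hpq : (p * q).1.dom = p.1.dom ∩ q.1.dom := Set.ext fun _ => Idem.mem_dom_mul
    rw [Bool.eq_iff_iff]
    simp only [hpq, Set.subset_inter_iff, decide_eq_true_eq, Bool.and_eq_true]
  ne_zero' := ⟨⟨1, isIdempotentElem_iff.2 fun _ _ => Option.some.inj⟩,
    decide_eq_true fun s _ => ⟨s, rfl⟩⟩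

theorem containsChar_eq_true {D : Set S} {p : Idem S} :
    containsChar D p = true ↔ D ⊆ p.1.dom := by
  classical exact decide_eq_true_iff

theorem containsChar_eq_false {D : Set S} {p : Idem S} :
    containsChar D p = false ↔ ¬ D ⊆ p.1.dom := by
  classical exact decide_eq_false_iff_not

theorem tendsto_pointChar_cofinite {ι : Type*} {D : Set S} {c : ι → S} (hc : ∀ i, c i ∈ D)
    (hD : ∀ Z, IsConstructible Z → D ⊆ Z ∨ {i | c i ∈ Z}.Finite) :
    Tendsto (fun i => pointChar (c i)) cofinite (𝓝 (containsChar D)) := by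
  have hind : Topology.IsInducing (SemiChar.toFun (S := S)) := ⟨rfl⟩
  rw [hind.tendsto_nhds_iff, tendsto_pi_nhds]
  intro p
  refine tendsto_nhds_of_eventually_eq ?_
  change ∀ᶠ i in cofinite, pointChar (c i) p = containsChar D p
  by_cases hp : D ⊆ p.1.dom
  · refine Eventually.of_forall fun i => ?_
    rw [containsChar_eq_true.2 hp, pointChar_eq_true]
    exact hp (hc i)
  · have hfin := (hD _ p.isConstructible_dom).resolve_left hp
    refine hfin.eventually_cofinite_notMem.mono fun i hi => ?_
    rw [containsChar_eq_false.2 hp, pointChar_eq_false]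
    exact hi

end Topology

namespace Gen

/-- The generators `x_n` and `y_n`. -/
def isXY : Gen → Bool
  | .x _ | .y _ => true
  | .a | .b => false

/-- The change of index `y_n ↦ y_{n+k}` on generators; it fixes the `x_n`, so that both families of
defining relations read `a b c = b c'` with `c' = c.shift 1`. -/
def shift (k : ℤ) : Gen → Gen
  | .y n => .y (n + k)
  | c => c

theorem isXY_shift (k : ℤ) (c : Gen) : (c.shift k).isXY = c.isXY := by
  cases c <;> rfl

theorem shift_zero (c : Gen) : c.shift 0 = c := by
  cases c <;> simp [shift]

theorem shift_shift (k l : ℤ) (c : Gen) : (c.shift k).shift l = c.shift (k + l) := by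
  cases c <;> simp [shift, add_assoc]

theorem shift_injective (k : ℤ) : Function.Injective (shift k) :=
  Function.LeftInverse.injective (g := shift (-k)) fun c => by
    rw [shift_shift, add_neg_cancel, shift_zero]

/-- Left multiplication by a generator, on words reduced for the rewriting system
`a b c → b (c.shift 1)`. -/
def act : Gen → List Gen → List Gen
  | .a, .b :: c :: w => bif c.isXY then .b :: c.shift 1 :: w else .a :: .b :: c :: w
  | c, w => c :: w

theorem act_of_ne_a {c : Gen} (hc : c ≠ .a) (w : List Gen) : c.act w = c :: w := by
  unfold act
  split
  · exact absurd rfl hc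
  · rfl

theorem act_a_cases (w : List Gen) :
    (∃ c v, c.isXY ∧ w = .b :: c :: v ∧ act .a w = .b :: c.shift 1 :: v) ∨
      act .a w = .a :: w := by
  unfold act
  split
  next c v _ => cases h : c.isXY <;> simp [h]
  next => exact Or.inr rfl

theorem act_injective (c : Gen) : Function.Injective c.act := by
  intro v w h
  by_cases hc : c = .a
  · subst hc
    rcases act_a_cases v with ⟨d, v', -, rfl, hv⟩ | hv <;>
      rcases act_a_cases w with ⟨e, w', -, rfl, hw⟩ | hw <;>
      simp_all [(shift_injective 1).eq_iff]
  · rw [act_of_ne_a hc, act_of_ne_a hc] at h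
    exact List.tail_eq_of_cons_eq h

end Gen

namespace ExampleMonoid

/-- The class of a generator in the monoid. -/
def gen (c : Gen) : ExampleMonoid := PresentedMonoid.of GenRel c

theorem closure_range_gen : Submonoid.closure (Set.range gen) = ⊤ :=
  PresentedMonoid.closure_range_of GenRel

theorem gen_induction {P : ExampleMonoid → Prop} (one : P 1)
    (gen_mul : ∀ c s, P s → P (gen c * s)) (s : ExampleMonoid) : P s := by
  induction closure_range_gen ▸ Submonoid.mem_top s using Submonoid.closure_induction_left with
  | one => exact one
  | mul_left c hc s _ ih =>
    obtain ⟨c, rfl⟩ := hc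
    exact gen_mul c s ih

theorem eq_one_or_exists_eq_gen_mul (s : ExampleMonoid) : s = 1 ∨ ∃ c t, s = gen c * t := by
  induction s using gen_induction with
  | one => exact Or.inl rfl
  | gen_mul c s _ => exact Or.inr ⟨c, s, rfl⟩

theorem gen_a_mul_gen_b_mul {c : Gen} (hc : c.isXY) (s : ExampleMonoid) :
    gen .a * (gen .b * (gen c * s)) = gen .b * (gen (c.shift 1) * s) := by
  have h : gen .a * gen .b * gen c = gen .b * gen (c.shift 1) := by
    cases c with
    | x n => exact PresentedMonoid.mk_eq_mk_of_rel (GenRel.x n)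
    | y n => exact PresentedMonoid.mk_eq_mk_of_rel (GenRel.y n)
    | a | b => cases hc
  simpa only [mul_assoc] using congrArg (· * s) h

/-- The action of the monoid on reduced words. -/
def wordAct : ExampleMonoid →* Function.End (List Gen) :=
  PresentedMonoid.lift (M := Function.End (List Gen)) (fun c => c.act) <| by
    rintro _ _ (n | n) <;> rfl

/-- The reduced word representing an element. -/
def nf (s : ExampleMonoid) : List Gen := wordAct s []

theorem nf_gen_mul (c : Gen) (s : ExampleMonoid) : nf (gen c * s) = c.act (nf s) :=
  congrFun (wordAct.map_mul (gen c) s) []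

theorem prod_map_gen_act (c : Gen) (w : List Gen) :
    ((c.act w).map gen).prod = gen c * (w.map gen).prod := by
  by_cases hc : c = .a
  · subst hc
    rcases Gen.act_a_cases w with ⟨d, v, hd, rfl, h⟩ | h <;> rw [h]
    · simp only [List.map_cons, List.prod_cons, gen_a_mul_gen_b_mul hd]
    · rw [List.map_cons, List.prod_cons]
  · rw [Gen.act_of_ne_a hc, List.map_cons, List.prod_cons]

theorem prod_map_gen_nf (s : ExampleMonoid) : ((nf s).map gen).prod = s := by
  induction s using gen_induction with
  | one => rfl
  | gen_mul c s ih => rw [nf_gen_mul, prod_map_gen_act, ih]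

theorem nf_injective : Function.Injective nf := fun s t h => by
  rw [← prod_map_gen_nf s, h, prod_map_gen_nf]

instance isLeftCancelMul : IsLeftCancelMul ExampleMonoid where
  mul_left_cancel s := by
    induction s using gen_induction with
    | one => exact fun t u h => by simpa only [one_mul] using h
    | gen_mul c s ih =>
      intro t u h
      have hnf : c.act (nf (s * t)) = c.act (nf (s * u)) := by
        simpa only [mul_assoc, nf_gen_mul] using congrArg nf h
      exact ih (nf_injective (c.act_injective hnf))

theorem head?_nf_gen_mul (c : Gen) (s : ExampleMonoid) :
    (nf (gen c * s)).head? = some c ∨ c = .a ∧ (nf (gen c * s)).head? = some .b := by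
  rw [nf_gen_mul]
  by_cases hc : c = .a
  · subst hc
    rcases Gen.act_a_cases (nf s) with ⟨d, w, -, -, h⟩ | h <;> simp [h]
  · simp [Gen.act_of_ne_a hc]

theorem gen_mul_eq_gen_mul_iff {c d : Gen} (hc : c.isXY) {s t : ExampleMonoid} :
    gen c * s = gen d * t ↔ c = d ∧ s = t := by
  refine ⟨fun h => ?_, fun ⟨hcd, hst⟩ => hcd ▸ hst ▸ rfl⟩
  have hcd : c = d := by
    have hhead := head?_nf_gen_mul c s
    rw [h] at hhead
    rcases hhead with hcd | ⟨rfl, -⟩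
    · rcases head?_nf_gen_mul d t with hd | ⟨-, hd⟩
      · exact Option.some.inj (hcd.symm.trans hd)
      · cases Option.some.inj (hcd.symm.trans hd)
        cases hc
    · cases hc
  subst hcd
  exact ⟨rfl, mul_left_cancel h⟩

theorem gen_eq_gen_mul_iff {c d : Gen} (hc : c.isXY) {t : ExampleMonoid} :
    gen c = gen d * t ↔ c = d ∧ t = 1 := by
  rw [← mul_one (gen c), gen_mul_eq_gen_mul_iff hc, eq_comm (a := 1)]

theorem eq_one_of_gen_eq_mul {c d : Gen} (hc : c.isXY) (hcd : c ≠ d) {t u v : ExampleMonoid}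
    (hu : gen c = t * u) (hv : gen d = t * v) : t = 1 := by
  rcases eq_one_or_exists_eq_gen_mul t with rfl | ⟨e, t, rfl⟩
  · rfl
  · rw [mul_assoc] at hu hv
    obtain ⟨rfl, -⟩ := (gen_eq_gen_mul_iff hc).1 hu
    rw [← mul_one (gen d), eq_comm, gen_mul_eq_gen_mul_iff hc] at hv
    exact absurd hv.1 hcd

theorem gen_a_mul_eq_gen_b_mul_iff {s t : ExampleMonoid} :
    gen .a * s = gen .b * t ↔
      ∃ c z, c.isXY ∧ s = gen .b * (gen c * z) ∧ t = gen (c.shift 1) * z := by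
  constructor
  · intro h
    have hnf := congrArg nf h
    rw [nf_gen_mul, nf_gen_mul, Gen.act_of_ne_a (c := .b) nofun] at hnf
    rcases Gen.act_a_cases (nf s) with ⟨c, w, hc, hs, hact⟩ | hact <;> rw [hact] at hnf
    · refine ⟨c, (w.map gen).prod, hc, ?_, ?_⟩
      · rw [← prod_map_gen_nf s, hs, List.map_cons, List.prod_cons, List.map_cons, List.prod_cons]
      · rw [← prod_map_gen_nf t, ← List.tail_eq_of_cons_eq hnf, List.map_cons, List.prod_cons]
    · cases hnf
  · rintro ⟨c, z, hc, rfl, rfl⟩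
    exact gen_a_mul_gen_b_mul hc z

end ExampleMonoid

section Graph

variable {S : Type*} [Monoid S]

/-- The graph of the left translation `t ↦ s * t`. Relations compose in diagrammatic order, so that
`mulRel (s * t) = mulRel t ○ mulRel s`. -/
def mulRel (s : S) : SetRel S S := (s * ·).graph

theorem mulRel_one : mulRel (1 : S) = SetRel.id := by
  simp [mulRel, ← Function.graph_id, Function.id_def]

theorem mulRel_mul (s t : S) : mulRel (s * t) = mulRel t ○ mulRel s := by
  simp only [mulRel, ← Function.graph_comp, Function.comp_def, mul_assoc]

variable [IsLeftCancelMul S]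

theorem mulRel_comp_inv_self (s : S) : mulRel s ○ (mulRel s).inv = SetRel.id := by
  ext ⟨u, v⟩
  simp [mulRel, eq_comm]

/-- The graph of a partial bijection in the left inverse hull. -/
def Hull.graph (g : Hull S) : SetRel S S := {p | g p.1 = some p.2}

theorem Hull.graph_one : (1 : Hull S).graph = SetRel.id :=
  Set.ext fun _ => Option.some_inj

theorem Hull.graph_mul (g h : Hull S) : (g * h).graph = h.graph ○ g.graph :=
  Set.ext fun _ => Hull.mul_eq_some

theorem Hull.graph_inv (g : Hull S) : g⁻¹.graph = g.graph.inv :=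
  Set.ext fun _ => Hull.inv_eq_some

theorem Hull.graph_translation (s : S) : (Hull.translation s).graph = mulRel s :=
  Set.ext fun _ => Hull.translation_eq_some

end Graph

namespace ExampleMonoid

/-- The graph of the partial bijection `x_n z ↦ x_n z`, `y_n z ↦ y_{n+k} z`. -/
def shiftRel (k : ℤ) : SetRel ExampleMonoid ExampleMonoid :=
  {p | ∃ c z, c.isXY ∧ p.1 = gen c * z ∧ p.2 = gen (c.shift k) * z}

/-- The right ideal generated by the `x_n` and the `y_n`. -/
def xyIdeal : Set ExampleMonoid := {u | ∃ c z, c.isXY ∧ u = gen c * z}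

theorem gen_mem_xyIdeal {c : Gen} (hc : c.isXY) : gen c ∈ xyIdeal :=
  ⟨c, 1, hc, (mul_one _).symm⟩

theorem gen_mul_mem_shiftRel_iff {k : ℤ} {c : Gen} {z v : ExampleMonoid} :
    (gen c * z) ~[shiftRel k] v ↔ c.isXY ∧ v = gen (c.shift k) * z := by
  constructor
  · rintro ⟨d, w, hd, h, hv⟩
    obtain ⟨rfl, rfl⟩ := (gen_mul_eq_gen_mul_iff hd).1 h.symm
    exact ⟨hd, hv⟩
  · rintro ⟨hc, hv⟩
    exact ⟨c, z, hc, rfl, hv⟩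

theorem shiftRel_comp (k l : ℤ) : shiftRel k ○ shiftRel l = shiftRel (k + l) := by
  ext ⟨u, w⟩
  constructor
  · rintro ⟨v, ⟨c, z, hc, hu, hv⟩, hw⟩
    obtain rfl : v = _ := hv
    rw [gen_mul_mem_shiftRel_iff, Gen.shift_shift] at hw
    exact ⟨c, z, hc, hu, hw.2⟩
  · rintro ⟨c, z, hc, hu, hw⟩
    refine ⟨gen (c.shift k) * z, ⟨c, z, hc, hu, rfl⟩, ?_⟩
    rw [gen_mul_mem_shiftRel_iff, Gen.isXY_shift, Gen.shift_shift]
    exact ⟨hc, hw⟩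

theorem shiftRel_inv (k : ℤ) : (shiftRel k).inv = shiftRel (-k) := by
  have symm (k : ℤ) {u v : ExampleMonoid} (h : u ~[shiftRel k] v) : v ~[shiftRel (-k)] u := by
    obtain ⟨c, z, hc, hu, hv⟩ := h
    refine ⟨c.shift k, z, ?_, hv, ?_⟩
    · rwa [Gen.isXY_shift]
    · rwa [Gen.shift_shift, add_neg_cancel, Gen.shift_zero]
  ext ⟨u, v⟩
  exact ⟨symm k, fun h => neg_neg k ▸ symm (-k) h⟩

theorem cod_shiftRel (k : ℤ) : (shiftRel k).cod = xyIdeal := by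
  rw [← SetRel.dom_inv, shiftRel_inv]
  ext u
  constructor
  · rintro ⟨v, c, z, hc, hu, -⟩
    exact ⟨c, z, hc, hu⟩
  · rintro ⟨c, z, hc, hu⟩
    exact ⟨_, c, z, hc, hu, rfl⟩

theorem mulRel_gen_comp_shiftRel {c : Gen} (hc : c.isXY) (k : ℤ) :
    mulRel (gen c) ○ shiftRel k = mulRel (gen (c.shift k)) := by
  ext ⟨u, v⟩
  simp [mulRel, gen_mul_mem_shiftRel_iff, hc, eq_comm]

theorem mulRel_gen_comp_shiftRel_eq_empty {c : Gen} (hc : ¬ c.isXY) (k : ℤ) :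
    mulRel (gen c) ○ shiftRel k = ∅ := by
  ext ⟨u, v⟩
  simp [mulRel, gen_mul_mem_shiftRel_iff, hc]

theorem mulRel_gen_comp_inv_eq_empty {c d : Gen} (h : c.isXY ∨ d.isXY) (hcd : c ≠ d) :
    mulRel (gen c) ○ (mulRel (gen d)).inv = ∅ := by
  have hne (u v : ExampleMonoid) : gen c * u ≠ gen d * v := fun huv => h.elim
    (fun hc => hcd ((gen_mul_eq_gen_mul_iff hc).1 huv).1)
    (fun hd => hcd ((gen_mul_eq_gen_mul_iff hd).1 huv.symm).1.symm)
  ext ⟨u, v⟩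
  simpa [mulRel, eq_comm] using hne u v

theorem mulRel_a_comp_inv_b :
    mulRel (gen .a) ○ (mulRel (gen .b)).inv = (mulRel (gen .b)).inv ○ shiftRel 1 := by
  ext ⟨u, v⟩
  simp only [SetRel.mem_comp, SetRel.mem_inv, mulRel, Function.mem_graph, exists_eq_left',
    eq_comm (a := gen .b * v), gen_a_mul_eq_gen_b_mul_iff]
  constructor
  · rintro ⟨c, z, hc, rfl, rfl⟩
    exact ⟨gen c * z, rfl, gen_mul_mem_shiftRel_iff.2 ⟨hc, rfl⟩⟩
  · rintro ⟨_, rfl, c, z, hc, rfl, hv⟩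
    exact ⟨c, z, hc, rfl, hv⟩

theorem mulRel_b_comp_inv_a :
    mulRel (gen .b) ○ (mulRel (gen .a)).inv = shiftRel (-1) ○ mulRel (gen .b) := by
  simpa only [SetRel.inv_comp, SetRel.inv_inv, shiftRel_inv] using
    congrArg SetRel.inv mulRel_a_comp_inv_b

/-- The relations which are empty or of the form `t σ s⁻¹`, where `σ` is the identity or a shift of
`xyIdeal`. They turn out to contain the graphs of all elements of the left inverse hull. -/
def IsStandard (R : SetRel ExampleMonoid ExampleMonoid) : Prop :=
  R = ∅ ∨ ∃ s t σ, (σ = SetRel.id ∨ ∃ k, σ = shiftRel k) ∧ R = (mulRel s).inv ○ σ ○ mulRel t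

namespace IsStandard

variable {R : SetRel ExampleMonoid ExampleMonoid}

theorem empty : IsStandard ∅ := Or.inl rfl

theorem comp_mulRel (hR : IsStandard R) (u : ExampleMonoid) : IsStandard (R ○ mulRel u) := by
  rcases hR with rfl | ⟨s, t, σ, hσ, rfl⟩
  · rw [SetRel.empty_comp]
    exact empty
  · exact Or.inr ⟨s, u * t, σ, hσ, by rw [mulRel_mul, SetRel.comp_assoc]⟩

theorem comp_shiftRel (hR : IsStandard R) (k : ℤ) : IsStandard (R ○ shiftRel k) := by
  rcases hR with rfl | ⟨s, t, σ, hσ, rfl⟩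
  · rw [SetRel.empty_comp]
    exact empty
  rcases eq_one_or_exists_eq_gen_mul t with rfl | ⟨c, t, rfl⟩
  · rw [mulRel_one, SetRel.comp_id]
    rcases hσ with rfl | ⟨l, rfl⟩
    · exact Or.inr ⟨s, 1, _, Or.inr ⟨k, rfl⟩, by rw [SetRel.comp_id, mulRel_one, SetRel.comp_id]⟩
    · exact Or.inr ⟨s, 1, _, Or.inr ⟨l + k, rfl⟩, by
        rw [SetRel.comp_assoc, shiftRel_comp, mulRel_one, SetRel.comp_id]⟩
  · rw [mulRel_mul, SetRel.comp_assoc, SetRel.comp_assoc (mulRel t)]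
    by_cases hc : c.isXY
    · rw [mulRel_gen_comp_shiftRel hc, ← SetRel.comp_assoc]
      exact comp_mulRel (Or.inr ⟨s, t, σ, hσ, rfl⟩) _
    · rw [mulRel_gen_comp_shiftRel_eq_empty hc, SetRel.comp_empty, SetRel.comp_empty]
      exact empty

theorem inv_mulRel_comp_inv_gen {s : ExampleMonoid} {σ : SetRel ExampleMonoid ExampleMonoid}
    (hσ : σ = SetRel.id ∨ ∃ k, σ = shiftRel k) (c : Gen) :
    IsStandard ((mulRel s).inv ○ σ ○ (mulRel (gen c)).inv) := by
  rcases hσ with rfl | ⟨k, rfl⟩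
  · refine Or.inr ⟨s * gen c, 1, _, Or.inl rfl, ?_⟩
    simp only [mulRel_mul, mulRel_one, SetRel.inv_comp, SetRel.comp_id]
  have hinv : shiftRel k ○ (mulRel (gen c)).inv = (mulRel (gen c) ○ shiftRel (-k)).inv := by
    rw [SetRel.inv_comp, shiftRel_inv, neg_neg]
  rw [SetRel.comp_assoc, hinv]
  by_cases hc : c.isXY
  · refine Or.inr ⟨s * gen (c.shift (-k)), 1, _, Or.inl rfl, ?_⟩
    simp only [mulRel_gen_comp_shiftRel hc, mulRel_mul, mulRel_one, SetRel.inv_comp,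
      SetRel.comp_id]
  · rw [mulRel_gen_comp_shiftRel_eq_empty hc, SetRel.inv_empty, SetRel.comp_empty]
    exact empty

theorem comp_inv_mulRel (hR : IsStandard R) (c : Gen) :
    IsStandard (R ○ (mulRel (gen c)).inv) := by
  rcases hR with rfl | ⟨s, t, σ, hσ, rfl⟩
  · rw [SetRel.empty_comp]
    exact empty
  induction t using gen_induction with
  | one =>
    rw [mulRel_one, SetRel.comp_id]
    exact inv_mulRel_comp_inv_gen hσ c
  | gen_mul d t ih =>
    rw [mulRel_mul, ← SetRel.comp_assoc, SetRel.comp_assoc _ (mulRel (gen d))]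
    by_cases hdc : d = c
    · rw [hdc, mulRel_comp_inv_self, SetRel.comp_id]
      exact Or.inr ⟨s, t, σ, hσ, rfl⟩
    match c, d with
    | .b, .a =>
      rw [mulRel_a_comp_inv_b, ← SetRel.comp_assoc]
      exact ih.comp_shiftRel 1
    | .a, .b =>
      rw [mulRel_b_comp_inv_a, ← SetRel.comp_assoc]
      exact (comp_shiftRel (Or.inr ⟨s, t, σ, hσ, rfl⟩) (-1)).comp_mulRel _
    | _, .x _ | _, .y _ =>
      rw [mulRel_gen_comp_inv_eq_empty (Or.inl rfl) hdc, SetRel.comp_empty]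
      exact empty
    | .x _, _ | .y _, _ =>
      rw [mulRel_gen_comp_inv_eq_empty (Or.inr rfl) hdc, SetRel.comp_empty]
      exact empty
    | .a, .a | .b, .b => exact absurd rfl hdc

end IsStandard

theorem isStandard_graph (g : Hull ExampleMonoid) : IsStandard g.graph := by
  induction g using Hull.induction_left closure_range_gen with
  | one =>
    refine Or.inr ⟨1, 1, _, Or.inl rfl, ?_⟩
    rw [Hull.graph_one, mulRel_one, SetRel.inv_id, SetRel.comp_id, SetRel.comp_id]
  | mul c _ g hg =>
    rw [Hull.graph_mul, Hull.graph_translation]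
    exact hg.comp_mulRel c
  | inv_mul c hc g hg =>
    obtain ⟨c, rfl⟩ := hc
    rw [Hull.graph_mul, Hull.graph_inv, Hull.graph_translation]
    exact hg.comp_inv_mulRel c

theorem eq_empty_or_range_or_image_of_isConstructible {Z : Set ExampleMonoid}
    (hZ : IsConstructible Z) :
    Z = ∅ ∨ (∃ t, Z = Set.range (t * ·)) ∨ ∃ t, Z = (t * ·) '' xyIdeal := by
  obtain ⟨g, hg⟩ := hZ.exists_range
  have hcod : Z = g.graph.cod := Set.ext hg
  rcases isStandard_graph g with h | ⟨s, t, σ, hσ, h⟩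
  · exact Or.inl (by rw [hcod, h, SetRel.cod_empty])
  have hZ' : Z = (t * ·) '' σ.cod := by
    ext v
    simp only [hcod, h, mulRel, SetRel.mem_cod, SetRel.mem_comp, SetRel.mem_inv,
      Function.mem_graph, Set.mem_image]
    constructor
    · rintro ⟨-, w, ⟨u, -, huw⟩, hv⟩
      exact ⟨w, ⟨u, huw⟩, hv⟩
    · rintro ⟨w, ⟨u, huw⟩, hv⟩
      exact ⟨s * u, w, ⟨u, rfl, huw⟩, hv⟩
  rcases hσ with rfl | ⟨k, rfl⟩
  · have hcod_id : (SetRel.id : SetRel ExampleMonoid ExampleMonoid).cod = Set.univ :=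
      Set.eq_univ_of_forall fun u => ⟨u, rfl⟩
    exact Or.inr (Or.inl ⟨t, by rw [hZ', hcod_id, Set.image_univ]⟩)
  · exact Or.inr (Or.inr ⟨t, by rw [hZ', cod_shiftRel]⟩)

theorem xyIdeal_subset_of_gen_mem {Z : Set ExampleMonoid} (hZ : IsConstructible Z) {c d : Gen}
    (hc : c.isXY) (hcd : c ≠ d) (hcZ : gen c ∈ Z) (hdZ : gen d ∈ Z) : xyIdeal ⊆ Z := by
  rcases eq_empty_or_range_or_image_of_isConstructible hZ with rfl | ⟨t, rfl⟩ | ⟨t, rfl⟩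
  · exact absurd hcZ (Set.notMem_empty _)
  · obtain ⟨u, hu⟩ := hcZ
    obtain ⟨v, hv⟩ := hdZ
    obtain rfl := eq_one_of_gen_eq_mul hc hcd hu.symm hv.symm
    exact fun s _ => ⟨s, one_mul s⟩
  · obtain ⟨u, -, hu⟩ := hcZ
    obtain ⟨v, -, hv⟩ := hdZ
    obtain rfl := eq_one_of_gen_eq_mul hc hcd hu.symm hv.symm
    exact fun s hs => ⟨s, hs, one_mul s⟩

theorem xyIdeal_subset_or_finite {ι : Type*} {c : ι → Gen} (hc : Function.Injective c)
    (hXY : ∀ i, (c i).isXY) {Z : Set ExampleMonoid} (hZ : IsConstructible Z) :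
    xyIdeal ⊆ Z ∨ {i | gen (c i) ∈ Z}.Finite := by
  refine or_iff_not_imp_right.2 fun hinf => ?_
  obtain ⟨i, hi, j, hj, hij⟩ := Set.Infinite.nontrivial hinf
  exact xyIdeal_subset_of_gen_mem hZ (hXY i) (hc.ne hij) hi hj

theorem eq_self_on_xyIdeal {g : Hull ExampleMonoid} {m n : ℤ} (hmn : m ≠ n)
    (hm : g (gen (.y m)) = some (gen (.y m))) (hn : g (gen (.y n)) = some (gen (.y n)))
    {u : ExampleMonoid} (hu : u ∈ xyIdeal) : g u = some u := by
  have hmn' : Gen.y m ≠ Gen.y n := fun h => hmn (Gen.y.inj h)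
  change u ~[g.graph] u
  replace hm : gen (.y m) ~[g.graph] gen (.y m) := hm
  replace hn : gen (.y n) ~[g.graph] gen (.y n) := hn
  rcases isStandard_graph g with h | ⟨s, t, σ, hσ, h⟩ <;> rw [h] at hm hn ⊢
  · exact hm.elim
  obtain ⟨v, ⟨w, hsm, -⟩, htm⟩ := id hm
  obtain ⟨v', ⟨w', hsn, -⟩, htn⟩ := id hn
  obtain rfl : s = 1 := eq_one_of_gen_eq_mul rfl hmn' (Eq.symm hsm) (Eq.symm hsn)
  obtain rfl : t = 1 := eq_one_of_gen_eq_mul rfl hmn' (Eq.symm htm) (Eq.symm htn)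
  rw [mulRel_one, SetRel.inv_id, SetRel.id_comp, SetRel.comp_id] at hm ⊢
  rcases hσ with rfl | ⟨k, rfl⟩
  · rfl
  · rw [← mul_one (gen _), gen_mul_mem_shiftRel_iff, gen_mul_eq_gen_mul_iff rfl] at hm
    obtain rfl : k = 0 := by simpa [Gen.shift] using hm.2.1
    obtain ⟨c, z, hc, rfl⟩ := hu
    rw [gen_mul_mem_shiftRel_iff, Gen.shift_zero]
    exact ⟨hc, rfl⟩

theorem exists_eq_self_on_xyIdeal {ι κ : Type*} [Finite ι] [Finite κ]
    {h : κ → Hull ExampleMonoid} {Z : ι → Set ExampleMonoid} (hZ : ∀ i, IsConstructible (Z i))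
    (hne : (xyIdeal \ ⋃ i, Z i).Nonempty)
    (hfix : xyIdeal \ ⋃ i, Z i ⊆ ⋃ k, {s | h k s = some s}) :
    ∃ k, ∀ s ∈ xyIdeal, h k s = some s := by
  obtain ⟨u, hu, huZ⟩ := hne
  have hfin : {n | gen (.y n) ∈ ⋃ i, Z i}.Finite := by
    simp only [Set.mem_iUnion, Set.ofPred_exists]
    exact Set.finite_iUnion fun i => (xyIdeal_subset_or_finite (fun _ _ => Gen.y.inj)
      (fun _ => rfl) (hZ i)).resolve_left fun hsub => huZ (Set.mem_iUnion.2 ⟨i, hsub hu⟩)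
  have hfix_y (n : ↥{n | gen (.y n) ∈ ⋃ i, Z i}ᶜ) :
      ∃ k, h k (gen (.y n)) = some (gen (.y n)) := by
    simpa only [Set.mem_iUnion, Set.mem_ofPred_eq] using hfix ⟨gen_mem_xyIdeal rfl, n.2⟩
  choose k hk using hfix_y
  have := hfin.infinite_compl.to_subtype
  obtain ⟨m, n, hmn, hkmn⟩ := Finite.exists_ne_map_eq_of_infinite k
  exact ⟨k m, fun s hs => eq_self_on_xyIdeal (Subtype.coe_ne_coe.2 hmn) (hk m)
    (hkmn ▸ hk n) hs⟩

theorem stronglyCStarRegular : StronglyCStarRegular ExampleMonoid := by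
  intro n m h X X' hX hX' hne hfix
  suffices H : ∃ k, ∀ s ∈ X, h k s = some s by
    obtain ⟨k, hk⟩ := H
    exact ⟨1, fun _ => X, fun _ => hX, fun _ => k, fun s hs => Set.mem_iUnion.2 ⟨0, hs.1⟩,
      fun _ => (mul_idemOf_eq_iff hX).2 hk⟩
  obtain ⟨u, huX, huX'⟩ := hne
  rcases eq_empty_or_range_or_image_of_isConstructible hX with rfl | ⟨t, rfl⟩ | ⟨t, rfl⟩
  · exact huX.elim
  · obtain ⟨z, rfl⟩ := huX
    have ht : t ∉ ⋃ i, X' i := fun ht => by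
      obtain ⟨i, hi⟩ := Set.mem_iUnion.1 ht
      exact huX' (Set.mem_iUnion.2 ⟨i, (hX' i).mul_mem hi z⟩)
    obtain ⟨k, hk⟩ := Set.mem_iUnion.1 (hfix ⟨⟨1, mul_one t⟩, ht⟩)
    refine ⟨k, ?_⟩
    rintro _ ⟨w, rfl⟩
    exact (h k).apply_mul hk w
  · obtain ⟨z, hz, rfl⟩ := huX
    obtain ⟨k, hk⟩ := exists_eq_self_on_xyIdeal
      (h := fun k => (Hull.translation t)⁻¹ * h k * Hull.translation t)
      (fun i => (hX' i).preimage_mul_left t) ⟨z, hz, by simpa using huX'⟩ fun s ⟨hs, hsX'⟩ => by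
        simpa only [Set.mem_iUnion, Set.mem_ofPred_eq, Hull.translation_inv_mul_mul_eq_some] using
          hfix ⟨Set.mem_image_of_mem _ hs, by simpa using hsX'⟩
    refine ⟨k, ?_⟩
    rintro _ ⟨s, hs, rfl⟩
    exact Hull.translation_inv_mul_mul_eq_some.1 (hk s hs)

theorem exists_eq_gen_b_mul_of_mem_inter {u v w : ExampleMonoid} (ha : u = gen .a * v)
    (hb : u = gen .b * w) : ∃ c z, c.isXY ∧ u = gen .b * (gen c * z) := by
  obtain ⟨c, z, hc, -, rfl⟩ := gen_a_mul_eq_gen_b_mul_iff.1 (ha.symm.trans hb)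
  exact ⟨c.shift 1, z, by rwa [Gen.isXY_shift], hb⟩

theorem not_finitelyAligned : ¬ FinitelyAligned ExampleMonoid := by
  intro h
  obtain ⟨F, hF, hab⟩ := h (gen .a) (gen .b)
  have hx (n : ℤ) : ∃ f : F, ∃ z, f.1 = gen .b * (gen (.x n) * z) := by
    have hbx : gen .b * gen (.x n) ∈ {u | ∃ f ∈ F, ∃ v, u = f * v} := by
      rw [← hab]
      exact ⟨⟨_, by simpa [Gen.shift] using
        (gen_a_mul_gen_b_mul (c := .x n) rfl 1).symm⟩, _, rfl⟩
    obtain ⟨f, hf, v, hv⟩ := hbx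
    have hfab : f ∈ {u | (∃ v, u = gen .a * v) ∧ ∃ v, u = gen .b * v} := by
      rw [hab]
      exact ⟨f, hf, 1, (mul_one f).symm⟩
    obtain ⟨⟨v₁, hv₁⟩, v₂, hv₂⟩ := hfab
    obtain ⟨c, z, -, hfc⟩ := exists_eq_gen_b_mul_of_mem_inter hv₁ hv₂
    rw [hfc, mul_assoc, mul_assoc, mul_right_inj, gen_eq_gen_mul_iff rfl] at hv
    exact ⟨⟨f, hf⟩, z, hv.1 ▸ hfc⟩
  choose f z hfz using hx
  have := hF.to_subtype
  obtain ⟨m, n, hmn, hfmn⟩ := Finite.exists_ne_map_eq_of_infinite f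
  have hz : gen (.x m) * z m = gen (.x n) * z n :=
    mul_left_cancel ((hfz m).symm.trans (hfmn ▸ hfz n))
  exact hmn (Gen.x.inj ((gen_mul_eq_gen_mul_iff rfl).1 hz).1)

/-- The element `b⁻¹ a b` of the left inverse hull. -/
noncomputable def shiftElt : Hull ExampleMonoid :=
  (Hull.translation (gen .b))⁻¹ * Hull.translation (gen .a) * Hull.translation (gen .b)

theorem graph_shiftElt : shiftElt.graph = shiftRel 1 := by
  rw [shiftElt, mul_assoc, Hull.graph_mul, Hull.graph_mul, Hull.graph_inv,
    Hull.graph_translation, Hull.graph_translation, SetRel.comp_assoc, mulRel_a_comp_inv_b,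
    ← SetRel.comp_assoc, mulRel_comp_inv_self, SetRel.id_comp]

theorem shiftElt_gen_eq_some_iff {c : Gen} {v : ExampleMonoid} :
    shiftElt (gen c) = some v ↔ c.isXY ∧ v = gen (c.shift 1) := by
  change gen c ~[shiftElt.graph] v ↔ _
  rw [graph_shiftElt, ← mul_one (gen c), gen_mul_mem_shiftRel_iff, mul_one]

open Filter in
theorem containsChar_xyIdeal_mem_closure :
    containsChar xyIdeal ∈ closure (pointChar '' {s | shiftElt s = some s}) := by
  have hlim := tendsto_pointChar_cofinite (c := fun n : ℤ => gen (.x n))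
    (fun n => gen_mem_xyIdeal rfl)
    (fun Z hZ => xyIdeal_subset_or_finite (fun _ _ => Gen.x.inj) (fun _ => rfl) hZ)
  exact mem_closure_of_tendsto hlim (Eventually.of_forall fun n =>
    Set.mem_image_of_mem _ (shiftElt_gen_eq_some_iff.2 ⟨rfl, rfl⟩))

theorem not_t2Space_GPArrow : ¬ T2Space (GPArrow ExampleMonoid) := by
  intro _
  obtain ⟨p, hp, hpD⟩ := exists_mul_idem_eq_of_t2Space containsChar_xyIdeal_mem_closure
  have hy : gen (.y 0) ∈ p.1.dom := containsChar_eq_true.1 hpD (gen_mem_xyIdeal rfl)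
  have hfix : shiftElt (gen (.y 0)) = some (gen (.y 0)) :=
    Hull.mul_idem_eq_iff.1 (hp.trans (one_mul p.1).symm) _ hy
  have hgen := (shiftElt_gen_eq_some_iff.1 hfix).2
  rw [← mul_one (gen (Gen.shift 1 (.y 0))), gen_eq_gen_mul_iff rfl] at hgen
  simpa [Gen.shift] using hgen.1

end ExampleMonoid

end LCMonoid

theorem proposition3p1 :
    ∃ _ : IsLeftCancelMul LCMonoid.ExampleMonoid,
      LCMonoid.StronglyCStarRegular LCMonoid.ExampleMonoid ∧
      ¬ LCMonoid.FinitelyAligned LCMonoid.ExampleMonoid ∧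
      ArrowGroupoid.IsTopologicalIso (LCMonoid.groupoidP LCMonoid.ExampleMonoid)
        (LCMonoid.groupoid LCMonoid.ExampleMonoid)
        (LCMonoid.canonicalMap LCMonoid.ExampleMonoid) ∧
      ¬ T2Space (LCMonoid.GPArrow LCMonoid.ExampleMonoid) ∧
      ¬ T2Space (LCMonoid.GArrow LCMonoid.ExampleMonoid) := by
  have hinj := LCMonoid.ExampleMonoid.stronglyCStarRegular.canonicalMap_injective
  refine ⟨LCMonoid.ExampleMonoid.isLeftCancelMul, LCMonoid.ExampleMonoid.stronglyCStarRegular,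
    LCMonoid.ExampleMonoid.not_finitelyAligned, LCMonoid.isTopologicalIso_canonicalMap hinj,
    LCMonoid.ExampleMonoid.not_t2Space_GPArrow, fun _ => ?_⟩
  exact LCMonoid.ExampleMonoid.not_t2Space_GPArrow
    (LCMonoid.isHomeomorph_canonicalMap hinj).isEmbedding.t2Space
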